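/- **Setting.** Let $N\ge 0$ be an integer, $\epsilon\neq 0$ and $T>0$ real, and let $\Lambda$ be the shift $(\Lambda g)(x)=g(x+\epsilon)$; operators $\sum_n A_n(x)\Lambda^n$ with $A_n:\mathbb R\to M_N(\mathbb C)$ are multiplied by $(X\Lambda^i)(Y\Lambda^j)=X(x)Y(x+i\epsilon)\Lambda^{i+j}$, and $A_+$, $A_-$, $\mathrm{Res}\,A$ denote the part of degree $\ge 0$, the part of degree $<0$, and the coefficient $A_0$. A point of the phase space is a pair of invertible dressing operators with smooth coefficients $$S=1+\omega_1(x)\Lambda^{-1}+\cdots,\qquad \bar S=\bar\omega_0(x)+\bar\omega_1(x)\Lambda+\cdots,\qquad L:=S\Lambda S^{-1}=\bar S\Lambda^{-1}\bar S^{-1},$$ so that $L=\Lambda+u+v\Lambda^{-1}$. Put $$C_{kk}=SE_{kk}S^{-1},\quad \bar C_{kk}=\bar SE_{kk}\bar S^{-1},\quad B_{jk}=SE_{kk}\Lambda^jS^{-1},\quad \bar B_{jk}=\bar SE_{kk}\Lambda^{-j}\bar S^{-1},$$ $$\log L=\tfrac12\big(S\,\epsilon\partial_x S^{-1}-\bar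 S\,\epsilon\partial_x\bar S^{-1}\big)=\tfrac12\big(\epsilon\bar S_x\bar S^{-1}-\epsilon S_xS^{-1}\big),\quad D_j=\tfrac{2}{j!}L^j(\log L-c_j),\quad c_j=\sum_{i=1}^j\tfrac1i .$$ The variable $x$ runs through a circle of length $T$: the coefficients of $L,C_{kk},\bar C_{kk},\log L$ (not necessarily those of $S,\bar S$) have period $T$, and $\int$ is the integral over one period. The flows of the extended multicomponent Toda hierarchy (EMTH) are, for $j\ge 0$ and $1\le k\le N$, $$\epsilon\partial S=-G_-S,\quad \epsilon\partial\bar S=G_+\bar S,\qquad G=B_{jk},\ \bar B_{jk},\ D_j\ \text{ for }\ \partial=\partial_{t_{j,k}},\ \partial_{\bar t_{j,k}},\ \partial_{s_j}\text{ respectively.}$$ Let $h_{n,k}=\mathrm{Tr\,Res}\,C_{kk}L^n$, $\bar h_{n,k}=\mathrm{Tr\,Res}\,\bar C_{kk}L^n$, $\tilde h_n=\frac2{n!}\mathrm{Tr\,Res}[L^n(\log L-c_n)]$ and $$H_{j,k}=\tfrac1{j+1}\int h_{j+1,k}\,dx,\qquad \bar H_{j,k}=\tfrac1{j+1}\int\bar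 h_{j+1,k}\,dx,\qquad \tilde H_j=\int\tilde h_{j+1}\,dx .$$ Smooth $T$-periodic functions $\frac{\delta F}{\delta u_{ij}},\frac{\delta F}{\delta v_{ij}}$ are called variational derivatives of a functional $F$ at a point if $\delta F=\int\sum_{i,j}\big(\frac{\delta F}{\delta u_{ij}}\delta u_{ij}+\frac{\delta F}{\delta v_{ij}}\delta v_{ij}\big)dx$ along every smooth one-parameter variation of the point in the phase space. For a functional $F$ and $w\in\{u_{ij},v_{ij}\}$, $\{w,F\}_a=\sum_{w'}\{w,w'\}_a\frac{\delta F}{\delta w'}$, where the brackets are skew-symmetric and given by $$\{u_{ij}(x),u_{pq}(y)\}_1=\tfrac1\epsilon[\delta_{iq}u_{pj}(x)-\delta_{jp}u_{iq}(x)]\delta(x-y),\quad \{u_{ij}(x),v_{pq}(y)\}_1=\tfrac1\epsilon[\delta_{iq}\Lambda v_{pj}(x)-\delta_{jp}v_{iq}(x)]\delta(x-y),\quad \{v_{ij},v_{pq}\}_1=0,$$ $$\begin{aligned}\{u_{ij}(x),u_{pq}(y)\}_2=\tfrac1\epsilon\big[&\delta_{iq}\Lambda v_{pj}-\delta_{jp}v_{iq}\Lambda^{-1}+\delta_{iq}\textstyle\sum_su_{sj}\Lambda(\Lambda-1)^{-1}u_{ps}-u_{pj}\Lambda(\Lambda-1)^{-1}u_{iq}\\&-u_{iq}(\Lambda-1)^{-1}u_{pj}+\delta_{jp}\textstyle\sum_su_{is}(\Lambda-1)^{-1}u_{sq}\big]\delta(x-y),\\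 \{u_{ij}(x),v_{pq}(y)\}_2=\tfrac1\epsilon\big[&\delta_{iq}\textstyle\sum_su_{sj}\Lambda^2(\Lambda-1)^{-1}v_{ps}-u_{pj}\Lambda(\Lambda-1)^{-1}v_{iq}\\&-u_{iq}(\Lambda-1)^{-1}\Lambda v_{pj}+\delta_{jp}\textstyle\sum_su_{is}(\Lambda-1)^{-1}v_{sq}\big]\delta(x-y),\\ \{v_{ij}(x),v_{pq}(y)\}_2=\tfrac1\epsilon\big[&\delta_{iq}\textstyle\sum_sv_{sj}\Lambda^2(\Lambda-1)^{-1}v_{ps}-v_{pj}\Lambda(\Lambda-1)^{-1}v_{iq}\\&-v_{iq}(\Lambda-1)^{-1}v_{pj}+\delta_{jp}\textstyle\sum_sv_{is}\Lambda^{-1}(\Lambda-1)^{-1}v_{sq}\big]\delta(x-y).\end{aligned}$$ In $\{\cdot,F\}_2$ the operator $(\Lambda-1)^{-1}$ acts only on the functions $$Q_{ij}=\sum_p\Big(\Lambda v_{pj}\tfrac{\delta F}{\delta v_{pi}}-v_{ip}\tfrac{\delta F}{\delta v_{jp}}+u_{pj}\tfrac{\delta F}{\delta u_{pi}}-u_{ip}\tfrac{\delta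 F}{\delta u_{jp}}\Big),$$ and $(\Lambda-1)^{-1}Q_{ij}$ means a smooth $T$-periodic function $R_{ij}$ with $(\Lambda-1)R_{ij}=Q_{ij}$. **Theorem.** For all the functionals $F=H_{j,k},\bar H_{j,k},\tilde H_j$ ($j\ge 0$, $1\le k\le N$) and all points of the phase space one can choose variational derivatives $\frac{\delta F}{\delta u_{ij}},\frac{\delta F}{\delta v_{ij}}$ of $F$ and functions $R_{ij}=(\Lambda-1)^{-1}Q_{ij}$ as above, such that, with this one choice in all brackets, the following hold. 1. All flows of the EMTH are Hamiltonian with respect to the first bracket: for $w=u_{pq}$ and $w=v_{pq}$, $$\frac{\partial w}{\partial t_{j,k}}=\{w,H_{j,k}\}_1,\qquad \frac{\partial w}{\partial\bar t_{j,k}}=\{w,\bar H_{j,k}\}_1,\qquad \frac{\partial w}{\partial s_j}=\{w,\tilde H_j\}_1 .$$ 2. For all $n\ge 1$ and $1\le k\le N$ the bi-Hamiltonian recursion relations hold: $$\{\cdot,H_{n-1,k}\}_2=\{\cdot,H_{n,k}\}_1,\qquad \{\cdot,\bar H_{n-1,k}\}_2=\{\cdot,\bar H_{n,k}\}_1,\qquad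 \{\cdot,\tilde H_{n-1}\}_2=n\{\cdot,\tilde H_n\}_1+\frac2{n!}\sum_{k=1}^N\{\cdot,H_{n,k}\}_1 .$$ -/

import Mathlib

open scoped ContDiff

noncomputable section

namespace EMTH

/-- A formal difference operator `∑_{n ∈ ℤ} A n (x) Λ^n` with coefficients `A n : ℝ → M_N(ℂ)`,
where `Λ` is the shift `x ↦ x + ε`. -/
abbrev DiffOp (N : ℕ) : Type := ℤ → ℝ → Matrix (Fin N) (Fin N) ℂ

variable {N : ℕ}

/-- The product determined by `(X Λ^i) (Y Λ^j) = X(x) Y(x + i ε) Λ^(i+j)`.  It is only used for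
factors whose product has finitely many terms in each degree (both bounded above, both bounded
below, or one of them a finite sum). -/
def mul (ε : ℝ) (A B : DiffOp N) : DiffOp N :=
  fun n x => ∑ᶠ m : ℤ, A m x * B (n - m) (x + m * ε)

/-- The operator `M Λ^d` with a constant matrix `M`. -/
def mono (d : ℤ) (M : Matrix (Fin N) (Fin N) ℂ) : DiffOp N :=
  fun n _ => if n = d then M else 0

/-- The identity operator. -/
def one : DiffOp N := mono 0 1

/-- Powers of an operator. -/
def pow (ε : ℝ) (A : DiffOp N) : ℕ → DiffOp N
  | 0 => one
  | j + 1 => mul ε A (pow ε A j)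

/-- The part of non-negative degree, `A_+`. -/
def pos (A : DiffOp N) : DiffOp N := fun n x => if 0 ≤ n then A n x else 0

/-- The part of negative degree, `A_-`. -/
def neg (A : DiffOp N) : DiffOp N := fun n x => if n < 0 then A n x else 0

/-- The coefficientwise derivative with respect to `x`. -/
def dx (A : DiffOp N) : DiffOp N :=
  fun n x => Matrix.of fun i j => deriv (fun y => A n y i j) x

/-- The density `Tr Res A`, the trace of the coefficient of `Λ^0`. -/
def trRes (A : DiffOp N) (x : ℝ) : ℂ := (A 0 x).trace

/-- All matrix entries of all coefficients are smooth functions of `x`. -/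
def IsSmooth (A : DiffOp N) : Prop :=
  ∀ (n : ℤ) (i j : Fin N), ContDiff ℝ ∞ (fun x => A n x i j)

/-- All coefficients have period `T` in `x`. -/
def IsPeriodic (T : ℝ) (A : DiffOp N) : Prop :=
  ∀ (n : ℤ) (x : ℝ), A n (x + T) = A n x

/-- The elementary matrix `E_kk`. -/
def E (k : Fin N) : Matrix (Fin N) (Fin N) ℂ := Matrix.single k k 1

/-- A pair of dressing operators `S`, `S̄` (written `Sb`) with their inverses. -/
structure Dressing (N : ℕ) where
  S : DiffOp N
  Sinv : DiffOp N
  Sb : DiffOp N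
  Sbinv : DiffOp N

/-- The Lax operator `L = S Λ S⁻¹`. -/
def lax (ε : ℝ) (d : Dressing N) : DiffOp N := mul ε d.S (mul ε (mono 1 1) d.Sinv)

/-- The second dressing of the Lax operator, `S̄ Λ⁻¹ S̄⁻¹`. -/
def laxBar (ε : ℝ) (d : Dressing N) : DiffOp N := mul ε d.Sb (mul ε (mono (-1) 1) d.Sbinv)

/-- `B_{jk} = S E_kk Λ^j S⁻¹`. -/
def B (ε : ℝ) (d : Dressing N) (j : ℕ) (k : Fin N) : DiffOp N :=
  mul ε d.S (mul ε (mono j (E k)) d.Sinv)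

/-- `B̄_{jk} = S̄ E_kk Λ^{-j} S̄⁻¹`. -/
def Bbar (ε : ℝ) (d : Dressing N) (j : ℕ) (k : Fin N) : DiffOp N :=
  mul ε d.Sb (mul ε (mono (-(j : ℤ)) (E k)) d.Sbinv)

/-- `C_kk = S E_kk S⁻¹`. -/
def C (ε : ℝ) (d : Dressing N) (k : Fin N) : DiffOp N :=
  mul ε d.S (mul ε (mono 0 (E k)) d.Sinv)

/-- `C̄_kk = S̄ E_kk S̄⁻¹`. -/
def Cbar (ε : ℝ) (d : Dressing N) (k : Fin N) : DiffOp N :=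
  mul ε d.Sb (mul ε (mono 0 (E k)) d.Sbinv)

/-- `log L = (log_+ L + log_- L) / 2` with
`log_+ L = S ε∂ S⁻¹ = ε∂ - ε S_x S⁻¹` and `log_- L = - S̄ ε∂ S̄⁻¹ = -ε∂ + ε S̄_x S̄⁻¹`.
The terms `± ε∂` cancel, so that `log L` is a difference operator. -/
def logL (ε : ℝ) (d : Dressing N) : DiffOp N :=
  (1 / 2 : ℂ) • ((ε : ℂ) • mul ε (dx d.Sb) d.Sbinv - (ε : ℂ) • mul ε (dx d.S) d.Sinv)

/-- `L^j (log L - c_j)` with `c_j = ∑_{i=1}^j 1/i`. -/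
def powLog (ε : ℝ) (d : Dressing N) (j : ℕ) : DiffOp N :=
  mul ε (pow ε (lax ε d) j) (logL ε d - ((harmonic j : ℚ) : ℂ) • one)

/-- `D_j = (2 / j!) L^j (log L - c_j)`. -/
def D (ε : ℝ) (d : Dressing N) (j : ℕ) : DiffOp N :=
  (2 / (j.factorial : ℂ)) • powLog ε d j

/-- The coefficient `u` of `L = Λ + u + v Λ⁻¹`. -/
def u (ε : ℝ) (d : Dressing N) : ℝ → Matrix (Fin N) (Fin N) ℂ := lax ε d 0

/-- The coefficient `v` of `L = Λ + u + v Λ⁻¹`. -/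
def v (ε : ℝ) (d : Dressing N) : ℝ → Matrix (Fin N) (Fin N) ℂ := lax ε d (-1)

/-- The points of the phase space.  The operators `S = 1 + ω₁ Λ⁻¹ + ⋯` and
`S̄ = ω̄₀ + ω̄₁ Λ + ⋯` are invertible, smooth, and dress the same Lax operator, which is therefore
of the form `Λ + u + v Λ⁻¹`.  The space variable runs through a circle of length `T`: the
coefficients of `L`, `C_kk`, `C̄_kk` and `log L`, and so all Hamiltonian densities, have period `T`
(the coefficients of `S` and `S̄` themselves need not be periodic). -/
structure IsAdmissible (ε T : ℝ) (d : Dressing N) : Prop where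
  S_zero : d.S 0 = 1
  S_pos : ∀ n : ℤ, 0 < n → d.S n = 0
  Sinv_pos : ∀ n : ℤ, 0 < n → d.Sinv n = 0
  Sb_neg : ∀ n : ℤ, n < 0 → d.Sb n = 0
  Sbinv_neg : ∀ n : ℤ, n < 0 → d.Sbinv n = 0
  S_mul_inv : mul ε d.S d.Sinv = one
  inv_mul_S : mul ε d.Sinv d.S = one
  Sb_mul_inv : mul ε d.Sb d.Sbinv = one
  inv_mul_Sb : mul ε d.Sbinv d.Sb = one
  S_smooth : IsSmooth d.S
  Sb_smooth : IsSmooth d.Sb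
  lax_eq : lax ε d = laxBar ε d
  lax_periodic : IsPeriodic T (lax ε d)
  C_periodic : ∀ k : Fin N, IsPeriodic T (C ε d k)
  Cbar_periodic : ∀ k : Fin N, IsPeriodic T (Cbar ε d k)
  log_periodic : IsPeriodic T (logL ε d)

/-- The phase space. -/
def Phase (N : ℕ) (ε T : ℝ) : Type := {d : Dressing N // IsAdmissible ε T d}

/-- The names `t_{j,k}`, `t̄_{j,k}`, `s_j` of the flows. -/
inductive Flow (N : ℕ) : Type
  | t (j : ℕ) (k : Fin N) : Flow N
  | tbar (j : ℕ) (k : Fin N) : Flow N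
  | s (j : ℕ) : Flow N

/-- The operator `B_{jk}`, `B̄_{jk}` or `D_j` which generates a flow. -/
def gen (ε : ℝ) (d : Dressing N) : Flow N → DiffOp N
  | Flow.t j k => B ε d j k
  | Flow.tbar j k => Bbar ε d j k
  | Flow.s j => D ε d j

/-- The family `γ` of points, depending on the time variable `τ ∈ 𝕜`, satisfies at `τ₀` the Sato
equations of the flow `f` with generator `G`:
`ε ∂S/∂τ = - G_- S` and `ε ∂S̄/∂τ = G_+ S̄`. -/
def SatoAt {𝕜 : Type} [NontriviallyNormedField 𝕜] [NormedAlgebra 𝕜 ℂ] {ε T : ℝ}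
    (f : Flow N) (γ : 𝕜 → Phase N ε T) (τ₀ : 𝕜) : Prop :=
  ∀ (n : ℤ) (x : ℝ) (i j : Fin N),
    HasDerivAt (fun τ => (γ τ).1.S n x i j)
      (-(1 / (ε : ℂ)) * mul ε (neg (gen ε (γ τ₀).1 f)) (γ τ₀).1.S n x i j) τ₀ ∧
    HasDerivAt (fun τ => (γ τ).1.Sb n x i j)
      ((1 / (ε : ℂ)) * mul ε (pos (gen ε (γ τ₀).1 f)) (γ τ₀).1.Sb n x i j) τ₀

/-- `h_{n,k} = Tr Res C_kk L^n`. -/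
def h (ε : ℝ) (d : Dressing N) (n : ℕ) (k : Fin N) : ℝ → ℂ :=
  trRes (mul ε (C ε d k) (pow ε (lax ε d) n))

/-- `h̄_{n,k} = Tr Res C̄_kk L^n`. -/
def hbar (ε : ℝ) (d : Dressing N) (n : ℕ) (k : Fin N) : ℝ → ℂ :=
  trRes (mul ε (Cbar ε d k) (pow ε (lax ε d) n))

/-- `h̃_n = (2 / n!) Tr Res [L^n (log L - c_n)]`. -/
def htilde (ε : ℝ) (d : Dressing N) (n : ℕ) : ℝ → ℂ :=
  fun x => (2 / (n.factorial : ℂ)) * trRes (powLog ε d n) x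

/-- The Hamiltonians `H_{j,k} = (1/(j+1)) ∫ h_{j+1,k} dx`, `H̄_{j,k} = (1/(j+1)) ∫ h̄_{j+1,k} dx`
and `H̃_j = ∫ h̃_{j+1} dx`, where the integral is over one period. -/
def Ham {ε T : ℝ} : Flow N → Phase N ε T → ℂ
  | Flow.t j k, p => (1 / ((j : ℂ) + 1)) * ∫ x in (0 : ℝ)..T, h ε p.1 (j + 1) k x
  | Flow.tbar j k, p => (1 / ((j : ℂ) + 1)) * ∫ x in (0 : ℝ)..T, hbar ε p.1 (j + 1) k x
  | Flow.s j, p => ∫ x in (0 : ℝ)..T, htilde ε p.1 (j + 1) x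

/-- A matrix array of smooth functions of period `T`. -/
def IsSmoothPeriodic (T : ℝ) (a : Fin N → Fin N → ℝ → ℂ) : Prop :=
  ∀ i j : Fin N, ContDiff ℝ ∞ (a i j) ∧ ∀ x, a i j (x + T) = a i j x

/-- A smooth one-parameter variation of a point of the phase space. -/
structure IsVariation {ε T : ℝ} (p : Phase N ε T) (γ : ℝ → Phase N ε T) : Prop where
  base : γ 0 = p
  S_smooth : ∀ (n : ℤ) (i j : Fin N),
    ContDiff ℝ ∞ (fun q : ℝ × ℝ => (γ q.1).1.S n q.2 i j)
  Sb_smooth : ∀ (n : ℤ) (i j : Fin N),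
    ContDiff ℝ ∞ (fun q : ℝ × ℝ => (γ q.1).1.Sb n q.2 i j)

/-- `du i j = δF/δu_ij` and `dv i j = δF/δv_ij` are variational derivatives of the functional `F`
at `p`: along every smooth variation,
`δF = ∫ ∑_{i,j} (δF/δu_ij · δu_ij + δF/δv_ij · δv_ij) dx`. -/
structure IsVarDeriv {ε T : ℝ} (F : Phase N ε T → ℂ) (p : Phase N ε T)
    (du dv : Fin N → Fin N → ℝ → ℂ) : Prop where
  du_smooth : IsSmoothPeriodic T du
  dv_smooth : IsSmoothPeriodic T dv
  variation : ∀ γ : ℝ → Phase N ε T, IsVariation p γ →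
    HasDerivAt (fun τ => F (γ τ))
      (∫ x in (0 : ℝ)..T, ∑ i, ∑ j,
        (du i j x * deriv (fun τ => u ε (γ τ).1 x i j) 0
          + dv i j x * deriv (fun τ => v ε (γ τ).1 x i j) 0)) 0

/-- `{u_ij, F}_1 = ∑_{p,q} {u_ij, u_pq}_1 δF/δu_pq + ∑_{p,q} {u_ij, v_pq}_1 δF/δv_pq`, where
`{u(x)_ij, u(y)_pq}_1 = (1/ε) [δ_iq u_pj(x) - δ_jp u_iq(x)] δ(x-y)` and
`{u(x)_ij, v(y)_pq}_1 = (1/ε) [δ_iq Λ v_pj(x) - δ_jp v_iq(x)] δ(x-y)`. -/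
def bracket1u (ε : ℝ) (d : Dressing N) (du dv : Fin N → Fin N → ℝ → ℂ)
    (i j : Fin N) (x : ℝ) : ℂ :=
  (1 / (ε : ℂ)) * ∑ p, ∑ q,
    (((if i = q then u ε d x p j * du p q x else 0)
        - (if j = p then u ε d x i q * du p q x else 0))
      + ((if i = q then v ε d (x + ε) p j * dv p q (x + ε) else 0)
        - (if j = p then v ε d x i q * dv p q x else 0)))

/-- `{v_ij, F}_1 = ∑_{p,q} {v_ij, u_pq}_1 δF/δu_pq`, since `{v_ij, v_pq}_1 = 0`, where by
skew-symmetry `{v(x)_ij, u(y)_pq}_1 = (1/ε) [δ_iq v_pj(x) - δ_jp v_iq(x) Λ⁻¹] δ(x-y)`. -/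
def bracket1v (ε : ℝ) (d : Dressing N) (du : Fin N → Fin N → ℝ → ℂ)
    (i j : Fin N) (x : ℝ) : ℂ :=
  (1 / (ε : ℂ)) * ∑ p, ∑ q,
    ((if i = q then v ε d x p j * du p q x else 0)
      - (if j = p then v ε d x i q * du p q (x - ε) else 0))

/-- The sum of all terms to which the non-local operator `(Λ - 1)⁻¹` is applied in the second
bracket, as an array with indices `i j`:
`∑_p (Λ v_pj δF/δv_pi - v_ip δF/δv_jp + u_pj δF/δu_pi - u_ip δF/δu_jp)`. -/
def nonlocalSource (ε : ℝ) (d : Dressing N) (du dv : Fin N → Fin N → ℝ → ℂ)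
    (i j : Fin N) (x : ℝ) : ℂ :=
  ∑ p, (v ε d (x + ε) p j * dv p i (x + ε) - v ε d x i p * dv j p x
    + u ε d x p j * du p i x - u ε d x i p * du j p x)

/-- `R` is a value of `(Λ - 1)⁻¹` at the source `∑_p (…)` of the second bracket, in the space of
smooth functions of period `T`. -/
structure IsNonlocalTerm (ε T : ℝ) (d : Dressing N) (du dv R : Fin N → Fin N → ℝ → ℂ) :
    Prop where
  smooth : IsSmoothPeriodic T R
  eq : ∀ (i j : Fin N) (x : ℝ), R i j (x + ε) - R i j x = nonlocalSource ε d du dv i j x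

/-- `{u_ij, F}_2 = ∑_{p,q} {u_ij, u_pq}_2 δF/δu_pq + ∑_{p,q} {u_ij, v_pq}_2 δF/δv_pq`, where
`ε {u_ij, u_pq}_2 = δ_iq Λ v_pj - δ_jp v_iq Λ⁻¹`
`  + ∑_s δ_iq u_sj Λ(Λ-1)⁻¹ u_ps - u_pj Λ(Λ-1)⁻¹ u_iq - u_iq (Λ-1)⁻¹ u_pj`
`  + ∑_s δ_jp u_is (Λ-1)⁻¹ u_sq` and
`ε {u_ij, v_pq}_2 = ∑_s δ_iq u_sj Λ²(Λ-1)⁻¹ v_ps - u_pj Λ(Λ-1)⁻¹ v_iq - u_iq (Λ-1)⁻¹ Λ v_pj`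
`  + ∑_s δ_jp u_is (Λ-1)⁻¹ v_sq`.
The terms with `(Λ-1)⁻¹` add up to `∑_s (u_sj Λ R_is - u_is R_sj)`. -/
def bracket2u (ε : ℝ) (d : Dressing N) (du R : Fin N → Fin N → ℝ → ℂ)
    (i j : Fin N) (x : ℝ) : ℂ :=
  (1 / (ε : ℂ)) *
    ((∑ p, ∑ q, ((if i = q then v ε d (x + ε) p j * du p q (x + ε) else 0)
        - (if j = p then v ε d x i q * du p q (x - ε) else 0)))
      + ∑ s, (u ε d x s j * R i s (x + ε) - u ε d x i s * R s j x))

/-- `{v_ij, F}_2 = ∑_{p,q} {v_ij, u_pq}_2 δF/δu_pq + ∑_{p,q} {v_ij, v_pq}_2 δF/δv_pq`, where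
`ε {v_ij, v_pq}_2 = ∑_s δ_iq v_sj Λ²(Λ-1)⁻¹ v_ps - v_pj Λ(Λ-1)⁻¹ v_iq - v_iq (Λ-1)⁻¹ v_pj`
`  + ∑_s δ_jp v_is Λ⁻¹(Λ-1)⁻¹ v_sq` and, by skew-symmetry of the bracket,
`ε {v_ij, u_pq}_2 = u_iq v_pj - v_iq Λ⁻¹ u_pj`
`  + ∑_s δ_iq v_sj Λ(Λ-1)⁻¹ u_ps - v_pj Λ(Λ-1)⁻¹ u_iq - v_iq Λ⁻¹(Λ-1)⁻¹ u_pj`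
`  + ∑_s δ_jp v_is Λ⁻¹(Λ-1)⁻¹ u_sq`.
The terms with `(Λ-1)⁻¹` add up to `∑_s (v_sj Λ R_is - v_is Λ⁻¹ R_sj)`. -/
def bracket2v (ε : ℝ) (d : Dressing N) (du R : Fin N → Fin N → ℝ → ℂ)
    (i j : Fin N) (x : ℝ) : ℂ :=
  (1 / (ε : ℂ)) *
    ((∑ p, ∑ q, (u ε d x i q * v ε d x p j * du p q x
        - v ε d x i q * u ε d (x - ε) p j * du p q (x - ε)))
      + ∑ s, (v ε d x s j * R i s (x + ε) - v ε d x i s * R s j (x - ε)))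

end EMTH

end

noncomputable section

namespace EMTH

variable {N : ℕ}

/-! Everything is governed by the generator `G` of a flow, that is `B_{jk}`, `B̄_{jk}` or `D_j`. Two
facts about it suffice: `G` commutes with `L` (`gen_commute`), and the variation of the Hamiltonian
is `∫ Tr Res (G δL)` (`hasDerivAt_Ham`).

Since `δL = δu + δv Λ⁻¹`, the second fact gives the transposes of `G_0(x)` and `G_1(x - ε)` as
variational derivatives in `u` and `v` (`isVarDeriv_Ham`). With these, the degree 0 part of `GL =
LG` turns `{u, H}_1` into `(1/ε)(Λ - 1) G_{-1}` (`bracket1u_eq`). The Sato equation for the first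
coefficients of `S` gives the same right-hand sides for the motion of `u` and `v`. The source of the
non-local term is also `(Λ - 1) G_{-1}` (`nonlocalSource_eq`), so `G_{-1}` is a periodic value of
`(Λ - 1)⁻¹` and no difference equation has to be solved. With this choice the second bracket for `G`
is the first bracket for `GL` (`bracket2u_eq`, `bracket2v_eq`). The recursion therefore reduces to
`B_{jk} L = B_{j+1,k}`, its barred analogue, and `D_j L = (j+1) D_{j+1} + (2/(j+1)!) ∑_k B_{j+1,k}`
(`D_succ`).

The analytic work lies in `δH = ∫ Tr Res (G δL)`. The integrated trace is cyclic on periodic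
operators (`tint_mul_comm`). For `H_{j,k}` the variation of the idempotent `C_kk` drops out, because
`C δC C = 0` and `C` commutes with `L` (`tint_idempotent`). For `H̃_j` one needs `∫ Tr Res L^(n+1)
δ(log L) = ∫ Tr Res L^n δL`, where cyclicity is not directly available because `S` need not be
periodic. With `m = S⁻¹ δS` the claim compares `m_x` with `Λ m Λ⁻¹ - m`. Translating `m` through
`sε`, `0 ≤ s ≤ 1`, interpolates between the two terms, and the trace has constant speed along the
way (`tint_conj_commutator`). This holds because `S` has an `x`-independent monodromy, so `S(x)
S(x+θ)⁻¹` is periodic (`per_mul_sh_inv`).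

Statements on the `S̄` side follow from the `S` side by the reflection `Λ ↦ Λ⁻¹`, `ε ↦ -ε`. -/

/-! ### Finiteness conditions for products of difference operators -/

/-- Every coefficient of the product of `A` and `B` is a finite sum. -/
class MulOK (A B : DiffOp N) : Prop where
  fin : ∀ n : ℤ, {m : ℤ | A m ≠ 0 ∧ B (n - m) ≠ 0}.Finite

/-- Every coefficient of the triple product of `A`, `B` and `C` is a finite sum. -/
class MulOK3 (A B C : DiffOp N) : Prop where
  fin : ∀ n : ℤ, {p : ℤ × ℤ | A p.1 ≠ 0 ∧ B p.2 ≠ 0 ∧ C (n - p.1 - p.2) ≠ 0}.Finite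

/-- The coefficients of `A` vanish in degrees above `a`. -/
def DegLE (a : ℤ) (A : DiffOp N) : Prop := ∀ n, a < n → A n = 0

/-- The coefficients of `A` vanish in degrees below `a`. -/
def DegGE (a : ℤ) (A : DiffOp N) : Prop := ∀ n, n < a → A n = 0

/-- Operators of degree bounded above. -/
class Lo (A : DiffOp N) : Prop where
  bdd : ∃ a, DegLE a A

/-- Operators of degree bounded below. -/
class Up (A : DiffOp N) : Prop where
  bdd : ∃ a, DegGE a A

theorem DegLE.le {a n : ℤ} {A : DiffOp N} (hA : DegLE a A) (hn : A n ≠ 0) : n ≤ a := by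
  by_contra hc; exact hn (hA n (by omega))

theorem DegGE.le {a n : ℤ} {A : DiffOp N} (hA : DegGE a A) (hn : A n ≠ 0) : a ≤ n := by
  by_contra hc; exact hn (hA n (by omega))

theorem DegLE.mono {a b : ℤ} {A : DiffOp N} (hA : DegLE a A) (hab : a ≤ b) : DegLE b A :=
  fun n hn => hA n (by omega)

theorem DegGE.mono {a b : ℤ} {A : DiffOp N} (hA : DegGE a A) (hab : b ≤ a) : DegGE b A :=
  fun n hn => hA n (by omega)

/-- The operator whose coefficients are translated by `θ`. -/
def sh (θ : ℝ) (A : DiffOp N) : DiffOp N := fun n x => A n (x + θ)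

/-- The reflection `Λ ↦ Λ⁻¹`. -/
def flip (A : DiffOp N) : DiffOp N := fun n => A (-n)

/-- The pairings that occur are bounded above on both factors (the `S` side), bounded below on both
(the `S̄` side), or have one finite band factor. `log L` is in general infinite in both directions,
so it is only multiplied by finite bands such as powers of `L`. -/
instance (priority := 900) mulOK_lo (A B : DiffOp N) [hA : Lo A] [hB : Lo B] : MulOK A B where
  fin n := by
    obtain ⟨a, ha⟩ := hA.bdd
    obtain ⟨b, hb⟩ := hB.bdd
    refine (Set.finite_Icc (n - b) a).subset fun m hm => ?_
    have h1 := ha.le hm.1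
    have h2 := hb.le hm.2
    constructor <;> omega

instance (priority := 800) mulOK_up (A B : DiffOp N) [hA : Up A] [hB : Up B] : MulOK A B where
  fin n := by
    obtain ⟨a, ha⟩ := hA.bdd
    obtain ⟨b, hb⟩ := hB.bdd
    refine (Set.finite_Icc a (n - b)).subset fun m hm => ?_
    have h1 := ha.le hm.1
    have h2 := hb.le hm.2
    constructor <;> omega

instance (priority := 700) mulOK_fin_left (A B : DiffOp N) [hA : Lo A] [hB : Up A] :
    MulOK A B where
  fin n := by
    obtain ⟨a, ha⟩ := hA.bdd
    obtain ⟨b, hb⟩ := hB.bdd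
    refine (Set.finite_Icc b a).subset fun m hm => ?_
    have h1 := ha.le hm.1
    have h2 := hb.le hm.1
    constructor <;> omega

instance (priority := 600) mulOK_fin_right (A B : DiffOp N) [hA : Lo B] [hB : Up B] :
    MulOK A B where
  fin n := by
    obtain ⟨a, ha⟩ := hA.bdd
    obtain ⟨b, hb⟩ := hB.bdd
    refine (Set.finite_Icc (n - a) (n - b)).subset fun m hm => ?_
    have h1 := ha.le hm.2
    have h2 := hb.le hm.2
    constructor <;> omega

instance (priority := 900) mulOK3_lo (A B C : DiffOp N) [hA : Lo A] [hB : Lo B] [hC : Lo C] :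
    MulOK3 A B C where
  fin n := by
    obtain ⟨a, ha⟩ := hA.bdd
    obtain ⟨b, hb⟩ := hB.bdd
    obtain ⟨c, hc⟩ := hC.bdd
    refine ((Set.finite_Icc (n - b - c) a).prod (Set.finite_Icc (n - a - c) b)).subset
      fun m hm => ?_
    have h1 := ha.le hm.1
    have h2 := hb.le hm.2.1
    have h3 := hc.le hm.2.2
    simp only [Set.mem_prod, Set.mem_Icc]
    omega

instance (priority := 800) mulOK3_up (A B C : DiffOp N) [hA : Up A] [hB : Up B] [hC : Up C] :
    MulOK3 A B C where
  fin n := by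
    obtain ⟨a, ha⟩ := hA.bdd
    obtain ⟨b, hb⟩ := hB.bdd
    obtain ⟨c, hc⟩ := hC.bdd
    refine ((Set.finite_Icc a (n - b - c)).prod (Set.finite_Icc b (n - a - c))).subset
      fun m hm => ?_
    have h1 := ha.le hm.1
    have h2 := hb.le hm.2.1
    have h3 := hc.le hm.2.2
    simp only [Set.mem_prod, Set.mem_Icc]
    omega

instance (priority := 700) mulOK3_left (A B C : DiffOp N) [hA : Lo A] [hA' : Up A] [hB : Lo B]
    [hB' : Up B] : MulOK3 A B C where
  fin n := by
    obtain ⟨a, ha⟩ := hA.bdd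
    obtain ⟨b, hb⟩ := hB.bdd
    obtain ⟨a', ha'⟩ := hA'.bdd
    obtain ⟨b', hb'⟩ := hB'.bdd
    refine ((Set.finite_Icc a' a).prod (Set.finite_Icc b' b)).subset fun m hm => ?_
    exact ⟨⟨ha'.le hm.1, ha.le hm.1⟩, ⟨hb'.le hm.2.1, hb.le hm.2.1⟩⟩

instance (priority := 600) mulOK3_right (A B C : DiffOp N) [hA : Lo C] [hA' : Up C] [hB : Lo B]
    [hB' : Up B] : MulOK3 A B C where
  fin n := by
    obtain ⟨a, ha⟩ := hA.bdd
    obtain ⟨b, hb⟩ := hB.bdd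
    obtain ⟨a', ha'⟩ := hA'.bdd
    obtain ⟨b', hb'⟩ := hB'.bdd
    refine ((Set.finite_Icc (n - a - b) (n - a' - b')).prod (Set.finite_Icc b' b)).subset
      fun m hm => ?_
    have h1 := ha.le hm.2.2
    have h2 := ha'.le hm.2.2
    have h3 := hb.le hm.2.1
    have h4 := hb'.le hm.2.1
    simp only [Set.mem_prod, Set.mem_Icc]
    omega

instance (priority := 500) mulOK3_sides (A B C : DiffOp N) [hA : Lo C] [hA' : Up C] [hB : Lo A]
    [hB' : Up A] : MulOK3 A B C where
  fin n := by
    obtain ⟨a, ha⟩ := hA.bdd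
    obtain ⟨b, hb⟩ := hB.bdd
    obtain ⟨a', ha'⟩ := hA'.bdd
    obtain ⟨b', hb'⟩ := hB'.bdd
    refine ((Set.finite_Icc b' b).prod (Set.finite_Icc (n - b - a) (n - b' - a'))).subset
      fun m hm => ?_
    have h1 := ha.le hm.2.2
    have h2 := ha'.le hm.2.2
    have h3 := hb.le hm.1
    have h4 := hb'.le hm.1
    simp only [Set.mem_prod, Set.mem_Icc]
    omega

/-! ### Products -/

theorem mul_eq_sum (ε : ℝ) (A B : DiffOp N) (n : ℤ) (s : Finset ℤ)
    (hs : ∀ m, A m ≠ 0 → B (n - m) ≠ 0 → m ∈ s) (x : ℝ) :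
    mul ε A B n x = ∑ m ∈ s, A m x * B (n - m) (x + m * ε) := by
  unfold mul
  refine finsum_eq_sum_of_support_subset _ fun m hm => ?_
  rw [Function.mem_support] at hm
  refine hs m (fun h0 => hm ?_) (fun h0 => hm ?_) <;> simp [h0]

/-- The degrees which contribute to the coefficient of degree `n` of a product. -/
def supp (A B : DiffOp N) [MulOK A B] (n : ℤ) : Finset ℤ :=
  (MulOK.fin (A := A) (B := B) n).toFinset

theorem mul_eq_sum_supp (ε : ℝ) (A B : DiffOp N) [MulOK A B] (n : ℤ) (x : ℝ) :
    mul ε A B n x = ∑ m ∈ supp A B n, A m x * B (n - m) (x + m * ε) :=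
  mul_eq_sum ε A B n _ (fun m h1 h2 => by simp [supp, h1, h2]) x

theorem mul_finite_support (ε : ℝ) (A B : DiffOp N) [MulOK A B] (n : ℤ) (x : ℝ) :
    (Function.support fun m : ℤ => A m x * B (n - m) (x + m * ε)).Finite := by
  refine (MulOK.fin (A := A) (B := B) n).subset fun m hm => ?_
  rw [Function.mem_support] at hm
  refine ⟨fun h0 => hm ?_, fun h0 => hm ?_⟩ <;> simp [h0]

/-- Both sides rearrange one finite double sum over the triples of degrees with nonzero
coefficients. Finiteness of the pairwise products alone would not justify the exchange, hence the
separate triple condition. -/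
theorem opmul_assoc (ε : ℝ) (A B C : DiffOp N) [MulOK A B] [MulOK B C] [MulOK3 A B C] :
    mul ε (mul ε A B) C = mul ε A (mul ε B C) := by
  funext n x
  set P := (MulOK3.fin (A := A) (B := B) (C := C) n).toFinset with hP
  have memP : ∀ i j, A i ≠ 0 → B j ≠ 0 → C (n - i - j) ≠ 0 → (i, j) ∈ P := by
    intro i j h1 h2 h3; simp [hP, h1, h2, h3]
  let f : ℤ → ℤ → Matrix (Fin N) (Fin N) ℂ := fun k m =>
    A m x * B (k - m) (x + m * ε) * C (n - k) (x + k * ε)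
  have hf : ∀ k m, f k m ≠ 0 → (m, k - m) ∈ P := by
    intro k m hkm
    refine memP _ _ (fun h0 => hkm ?_) (fun h0 => hkm ?_) (fun h0 => hkm ?_)
    · simp [f, h0]
    · simp [f, h0]
    · have hn : C (n - k) = 0 := by rw [← h0]; congr 1; ring
      simp [f, hn]
  set K := P.image (fun p => p.1 + p.2)
  set I := P.image Prod.fst
  have hK : ∀ k m, f k m ≠ 0 → k ∈ K := fun k m hkm =>
    Finset.mem_image.2 ⟨_, hf k m hkm, by simp⟩
  have hI : ∀ k m, f k m ≠ 0 → m ∈ I := fun k m hkm =>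
    Finset.mem_image.2 ⟨_, hf k m hkm, by simp⟩
  have hleft : mul ε (mul ε A B) C n x = ∑ k ∈ K, ∑ m ∈ I, f k m := by
    have h1 : ∀ k : ℤ, mul ε A B k x * C (n - k) (x + k * ε) = ∑ m ∈ I, f k m := by
      intro k
      unfold mul
      rw [finsum_mul' _ _ (mul_finite_support ε A B k x)]
      exact finsum_eq_sum_of_support_subset _ fun m hm => hI k m hm
    show (∑ᶠ k : ℤ, mul ε A B k x * C (n - k) (x + k * ε)) = _
    simp_rw [h1]
    refine finsum_eq_sum_of_support_subset _ fun k hk => ?_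
    obtain ⟨m, -, hm⟩ := Finset.exists_ne_zero_of_sum_ne_zero hk
    exact hK k m hm
  have hright : mul ε A (mul ε B C) n x = ∑ m ∈ I, ∑ k ∈ K, f k m := by
    have h1 : ∀ m : ℤ, A m x * mul ε B C (n - m) (x + m * ε) = ∑ k ∈ K, f k m := by
      intro m
      have h2 : mul ε B C (n - m) (x + m * ε)
          = ∑ᶠ k : ℤ, B (k - m) (x + m * ε) * C (n - k) (x + k * ε) := by
        unfold mul
        rw [← finsum_comp_equiv (Equiv.subRight m)]
        refine finsum_congr fun k => ?_
        simp only [Equiv.subRight_apply]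
        rw [show n - m - (k - m) = n - k by ring,
          show x + m * ε + ((k - m : ℤ) : ℝ) * ε = x + k * ε by push_cast; ring]
      rw [h2, mul_finsum']
      · have h3 : ∀ k : ℤ, A m x * (B (k - m) (x + m * ε) * C (n - k) (x + k * ε)) = f k m :=
          fun k => by simp only [f, mul_assoc]
        simp_rw [h3]
        exact finsum_eq_sum_of_support_subset _ fun k hk => hK k m hk
      · refine ((MulOK.fin (A := B) (B := C) (n - m)).image (fun k => k + m)).subset ?_
        intro k hk
        rw [Function.mem_support] at hk
        refine ⟨k - m, ⟨fun h0 => hk ?_, fun h0 => hk ?_⟩, by simp⟩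
        · simp [h0]
        · rw [show n - m - (k - m) = n - k by ring] at h0; simp [h0]
    show (∑ᶠ m : ℤ, A m x * mul ε B C (n - m) (x + m * ε)) = _
    simp_rw [h1]
    refine finsum_eq_sum_of_support_subset _ fun m hm => ?_
    obtain ⟨k, -, hk⟩ := Finset.exists_ne_zero_of_sum_ne_zero hm
    exact hI k m hk
  rw [hleft, hright, Finset.sum_comm]

theorem opmul_add (ε : ℝ) (A B C : DiffOp N) [MulOK A B] [MulOK A C] :
    mul ε A (B + C) = mul ε A B + mul ε A C := by
  funext n x
  show _ = mul _ _ _ n x + mul _ _ _ n x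
  unfold mul
  rw [← finsum_add_distrib (mul_finite_support ε A B n x) (mul_finite_support ε A C n x)]
  exact finsum_congr fun m => mul_add _ _ _

theorem add_opmul (ε : ℝ) (A B C : DiffOp N) [MulOK A C] [MulOK B C] :
    mul ε (A + B) C = mul ε A C + mul ε B C := by
  funext n x
  show _ = mul _ _ _ n x + mul _ _ _ n x
  unfold mul
  rw [← finsum_add_distrib (mul_finite_support ε A C n x) (mul_finite_support ε B C n x)]
  exact finsum_congr fun m => add_mul _ _ _

theorem opmul_smul (ε : ℝ) (c : ℂ) (A B : DiffOp N) : mul ε A (c • B) = c • mul ε A B := by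
  funext n x
  simp only [Pi.smul_apply, mul, smul_finsum]
  simp

theorem smul_opmul (ε : ℝ) (c : ℂ) (A B : DiffOp N) : mul ε (c • A) B = c • mul ε A B := by
  funext n x
  simp only [Pi.smul_apply, mul, smul_finsum]
  simp

theorem opmul_neg (ε : ℝ) (A B : DiffOp N) : mul ε A (-B) = -mul ε A B := by
  have h := opmul_smul ε (-1) A B
  simpa using h

theorem neg_opmul (ε : ℝ) (A B : DiffOp N) : mul ε (-A) B = -mul ε A B := by
  have h := smul_opmul ε (-1) A B
  simpa using h

theorem opmul_zero (ε : ℝ) (A : DiffOp N) : mul ε A 0 = 0 := by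
  funext n x; simp [mul]

theorem zero_opmul (ε : ℝ) (A : DiffOp N) : mul ε 0 A = 0 := by
  funext n x; simp [mul]

theorem mono_mul (ε : ℝ) (d : ℤ) (M : Matrix (Fin N) (Fin N) ℂ) (A : DiffOp N) (n : ℤ) (x : ℝ) :
    mul ε (mono d M) A n x = M * A (n - d) (x + d * ε) := by
  rw [mul_eq_sum ε _ _ n {d}]
  · simp [mono]
  · intro m hm _
    by_contra hc
    exact hm (by funext y; simp [mono, Finset.mem_singleton.not.1 hc])

theorem mul_mono (ε : ℝ) (d : ℤ) (M : Matrix (Fin N) (Fin N) ℂ) (A : DiffOp N) (n : ℤ) (x : ℝ) :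
    mul ε A (mono d M) n x = A (n - d) x * M := by
  rw [mul_eq_sum ε _ _ n {n - d}]
  · simp [mono]
  · intro m _ hm
    by_contra hc
    refine hm (by funext y; simp only [mono]; rw [if_neg]; rfl; simp at hc; omega)

theorem one_opmul (ε : ℝ) (A : DiffOp N) : mul ε one A = A := by
  funext n x; simp [one, mono_mul]

theorem opmul_one (ε : ℝ) (A : DiffOp N) : mul ε A one = A := by
  funext n x; simp [one, mul_mono]

theorem mono_mul_mono (ε : ℝ) (d e : ℤ) (M M' : Matrix (Fin N) (Fin N) ℂ) :
    mul ε (mono d M) (mono e M') = mono (d + e) (M * M') := by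
  funext n x
  rw [mono_mul]
  simp only [mono]
  by_cases hn : n = d + e
  · rw [if_pos (by omega), if_pos hn]
  · rw [if_neg (by omega), if_neg hn]; simp

theorem sh_mul (ε θ : ℝ) (A B : DiffOp N) : sh θ (mul ε A B) = mul ε (sh θ A) (sh θ B) := by
  funext n x
  simp only [sh, mul]
  exact finsum_congr fun m => by rw [show x + θ + m * ε = x + m * ε + θ by ring]

theorem sh_mono (θ : ℝ) (d : ℤ) (M : Matrix (Fin N) (Fin N) ℂ) : sh θ (mono d M) = mono d M := rfl

theorem sh_sh (θ θ' : ℝ) (A : DiffOp N) : sh θ (sh θ' A) = sh (θ + θ') A := by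
  funext n x; simp [sh, add_assoc]

theorem sh_zero (A : DiffOp N) : sh 0 A = A := by
  funext n x; simp [sh]

theorem mono_mul_eq_sh (ε : ℝ) (A : DiffOp N) :
    mul ε (mono 1 1) A = mul ε (sh ε A) (mono 1 1) := by
  funext n x
  simp [mono_mul, mul_mono, sh]

/-- Reflection is multiplicative once the step changes sign. It turns operators bounded below into
operators bounded above, which transports results about `S` to `S̄`. -/
theorem flip_mul (ε : ℝ) (A B : DiffOp N) :
    flip (mul ε A B) = mul (-ε) (flip A) (flip B) := by
  funext n x
  simp only [flip, mul]
  rw [← finsum_comp_equiv (Equiv.neg ℤ)]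
  refine finsum_congr fun m => ?_
  simp only [Equiv.neg_apply]
  rw [show -n - -m = -(n - m) by ring, show ((-m : ℤ) : ℝ) * ε = m * -ε by push_cast; ring]

theorem flip_flip (A : DiffOp N) : flip (flip A) = A := by
  funext n; simp [flip]

theorem flip_mono (d : ℤ) (M : Matrix (Fin N) (Fin N) ℂ) : flip (mono d M) = mono (-d) M := by
  funext n x
  simp only [flip, mono]
  exact if_congr (by omega) rfl rfl

theorem flip_one : flip (one : DiffOp N) = one := by
  simp [one, flip_mono]

theorem flip_dx (A : DiffOp N) : flip (dx A) = dx (flip A) := rfl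

/-! ### Degree bounds -/

theorem DegLE.mul {a b : ℤ} {A B : DiffOp N} (ε : ℝ) (hA : DegLE a A) (hB : DegLE b B) :
    DegLE (a + b) (mul ε A B) := by
  intro n hn
  funext x
  rw [mul_eq_sum ε A B n ∅]
  · rfl
  · intro m h1 h2
    have := hA.le h1
    have := hB.le h2
    omega

theorem DegGE.flip {a : ℤ} {A : DiffOp N} (hA : DegGE a A) : DegLE (-a) (flip A) :=
  fun n hn => hA (-n) (by omega)

theorem DegLE.flip {a : ℤ} {A : DiffOp N} (hA : DegLE a A) : DegGE (-a) (EMTH.flip A) :=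
  fun n hn => hA (-n) (by omega)

theorem DegGE.mul {a b : ℤ} {A B : DiffOp N} (ε : ℝ) (hA : DegGE a A) (hB : DegGE b B) :
    DegGE (a + b) (EMTH.mul ε A B) := by
  have h := (hA.flip.mul (-ε) hB.flip).flip
  rw [← flip_mul, flip_flip] at h
  convert h using 1; ring

theorem dx_eq_zero {A : DiffOp N} {n : ℤ} (hn : A n = 0) : dx A n = 0 := by
  funext x; ext i j; simp [dx, hn]

theorem DegLE.dx {a : ℤ} {A : DiffOp N} (hA : DegLE a A) : DegLE a (dx A) :=
  fun n hn => dx_eq_zero (hA n hn)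

theorem DegGE.dx {a : ℤ} {A : DiffOp N} (hA : DegGE a A) : DegGE a (EMTH.dx A) :=
  fun n hn => dx_eq_zero (hA n hn)

theorem mono_degLE (d : ℤ) (M : Matrix (Fin N) (Fin N) ℂ) : DegLE d (mono d M) := by
  intro n hn; funext x; simp [EMTH.mono, hn.ne']

theorem mono_degGE (d : ℤ) (M : Matrix (Fin N) (Fin N) ℂ) : DegGE d (mono d M) := by
  intro n hn; funext x; simp [EMTH.mono, hn.ne]

instance lo_mono (d : ℤ) (M : Matrix (Fin N) (Fin N) ℂ) : Lo (mono d M) := ⟨d, mono_degLE d M⟩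
instance up_mono (d : ℤ) (M : Matrix (Fin N) (Fin N) ℂ) : Up (mono d M) := ⟨d, mono_degGE d M⟩
instance lo_one : Lo (one : DiffOp N) := lo_mono 0 1
instance up_one : Up (one : DiffOp N) := up_mono 0 1
instance lo_zero : Lo (0 : DiffOp N) := ⟨0, fun _ _ => rfl⟩
instance up_zero : Up (0 : DiffOp N) := ⟨0, fun _ _ => rfl⟩

instance lo_mul (ε : ℝ) (A B : DiffOp N) [hA : Lo A] [hB : Lo B] : Lo (mul ε A B) := by
  obtain ⟨a, ha⟩ := hA.bdd
  obtain ⟨b, hb⟩ := hB.bdd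
  exact ⟨_, ha.mul ε hb⟩

instance up_mul (ε : ℝ) (A B : DiffOp N) [hA : Up A] [hB : Up B] : Up (mul ε A B) := by
  obtain ⟨a, ha⟩ := hA.bdd
  obtain ⟨b, hb⟩ := hB.bdd
  exact ⟨_, ha.mul ε hb⟩

instance lo_add (A B : DiffOp N) [hA : Lo A] [hB : Lo B] : Lo (A + B) := by
  obtain ⟨a, ha⟩ := hA.bdd
  obtain ⟨b, hb⟩ := hB.bdd
  refine ⟨max a b, fun n hn => ?_⟩
  simp [ha n (lt_of_le_of_lt (le_max_left _ _) hn), hb n (lt_of_le_of_lt (le_max_right _ _) hn)]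

instance up_add (A B : DiffOp N) [hA : Up A] [hB : Up B] : Up (A + B) := by
  obtain ⟨a, ha⟩ := hA.bdd
  obtain ⟨b, hb⟩ := hB.bdd
  refine ⟨min a b, fun n hn => ?_⟩
  simp [ha n (lt_of_lt_of_le hn (min_le_left _ _)), hb n (lt_of_lt_of_le hn (min_le_right _ _))]

instance lo_smul (c : ℂ) (A : DiffOp N) [hA : Lo A] : Lo (c • A) := by
  obtain ⟨a, ha⟩ := hA.bdd
  exact ⟨a, fun n hn => by simp [ha n hn]⟩

instance up_smul (c : ℂ) (A : DiffOp N) [hA : Up A] : Up (c • A) := by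
  obtain ⟨a, ha⟩ := hA.bdd
  exact ⟨a, fun n hn => by simp [ha n hn]⟩

instance lo_dx (A : DiffOp N) [hA : Lo A] : Lo (dx A) := by
  obtain ⟨a, ha⟩ := hA.bdd
  exact ⟨a, ha.dx⟩

instance up_dx (A : DiffOp N) [hA : Up A] : Up (dx A) := by
  obtain ⟨a, ha⟩ := hA.bdd
  exact ⟨a, ha.dx⟩

instance lo_sh (θ : ℝ) (A : DiffOp N) [hA : Lo A] : Lo (sh θ A) := by
  obtain ⟨a, ha⟩ := hA.bdd
  exact ⟨a, fun n hn => by funext x; simp [sh, ha n hn]⟩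

instance lo_flip (A : DiffOp N) [hA : Up A] : Lo (flip A) := by
  obtain ⟨a, ha⟩ := hA.bdd
  exact ⟨_, ha.flip⟩

instance up_flip (A : DiffOp N) [hA : Lo A] : Up (flip A) := by
  obtain ⟨a, ha⟩ := hA.bdd
  exact ⟨_, ha.flip⟩

instance lo_pow (ε : ℝ) (A : DiffOp N) [hA : Lo A] (n : ℕ) : Lo (pow ε A n) := by
  induction n with
  | zero => exact lo_one
  | succ n ih => exact lo_mul ε A _

instance up_pow (ε : ℝ) (A : DiffOp N) [hA : Up A] (n : ℕ) : Up (pow ε A n) := by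
  induction n with
  | zero => exact up_one
  | succ n ih => exact up_mul ε A _

theorem opmul_sub (ε : ℝ) (A B C : DiffOp N) [MulOK A B] [h : MulOK A C] :
    mul ε A (B - C) = mul ε A B - mul ε A C := by
  have : MulOK A (-C) := ⟨fun n => by simpa using h.fin n⟩
  rw [sub_eq_add_neg, opmul_add, opmul_neg, sub_eq_add_neg]

theorem sub_opmul (ε : ℝ) (A B C : DiffOp N) [MulOK A C] [h : MulOK B C] :
    mul ε (A - B) C = mul ε A C - mul ε B C := by
  have : MulOK (-B) C := ⟨fun n => by simpa using h.fin n⟩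
  rw [sub_eq_add_neg, add_opmul, neg_opmul, sub_eq_add_neg]

/-! ### Powers -/

theorem pow_succ_right (ε : ℝ) (A : DiffOp N) [Lo A] [Up A] (n : ℕ) :
    pow ε A (n + 1) = mul ε (pow ε A n) A := by
  induction n with
  | zero => simp [pow, one_opmul, opmul_one]
  | succ n ih =>
    show mul ε A (pow ε A (n + 1)) = mul ε (mul ε A (pow ε A n)) A
    rw [ih, opmul_assoc]

theorem flip_pow (ε : ℝ) (A : DiffOp N) (n : ℕ) :
    flip (pow ε A n) = pow (-ε) (flip A) n := by
  induction n with
  | zero => exact flip_one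
  | succ n ih => simp only [pow]; rw [flip_mul, ih]

theorem pow_commute (ε : ℝ) (A Z : DiffOp N) [Lo A] [Up A] (hZ : mul ε Z A = mul ε A Z) (n : ℕ) :
    mul ε Z (pow ε A n) = mul ε (pow ε A n) Z := by
  induction n with
  | zero => simp [pow, one_opmul, opmul_one]
  | succ n ih =>
    simp only [pow]
    rw [← opmul_assoc, hZ, opmul_assoc, ih, opmul_assoc]

/-! ### Smooth and periodic operators -/

/-- Smoothness of the coefficients, as a type class. -/
class Smo (A : DiffOp N) : Prop where
  out : IsSmooth A

/-- Periodicity of the coefficients, as a type class. -/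
class Per (T : ℝ) (A : DiffOp N) : Prop where
  out : IsPeriodic T A

theorem mul_apply_sum (ε : ℝ) (A B : DiffOp N) (n : ℤ) (s : Finset ℤ)
    (hs : ∀ m, A m ≠ 0 → B (n - m) ≠ 0 → m ∈ s) (x : ℝ) (i j : Fin N) :
    mul ε A B n x i j = ∑ m ∈ s, ∑ k, A m x i k * B (n - m) (x + m * ε) k j := by
  rw [mul_eq_sum ε A B n s hs, Matrix.sum_apply]
  simp only [Matrix.mul_apply]

theorem mem_supp (A B : DiffOp N) [MulOK A B] (n m : ℤ) (hA : A m ≠ 0) (hB : B (n - m) ≠ 0) :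
    m ∈ supp A B n := by
  simp [supp, hA, hB]

instance smo_mul (ε : ℝ) (A B : DiffOp N) [MulOK A B] [hA : Smo A] [hB : Smo B] :
    Smo (mul ε A B) where
  out n i j := by
    have h : (fun x => mul ε A B n x i j) =
        fun x => ∑ m ∈ supp A B n, ∑ k, A m x i k * B (n - m) (x + m * ε) k j :=
      funext fun x => mul_apply_sum ε A B n _ (mem_supp A B n) x i j
    rw [h]
    refine ContDiff.sum fun m _ => ContDiff.sum fun k _ => ?_
    exact (hA.out m i k).mul ((hB.out (n - m) k j).comp (contDiff_id.add contDiff_const))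

instance smo_mono (d : ℤ) (M : Matrix (Fin N) (Fin N) ℂ) : Smo (mono d M) where
  out n i j := by simp only [mono]; exact contDiff_const

instance smo_one : Smo (one : DiffOp N) := smo_mono 0 1

instance smo_add (A B : DiffOp N) [hA : Smo A] [hB : Smo B] : Smo (A + B) where
  out n i j := (hA.out n i j).add (hB.out n i j)

instance smo_smul (c : ℂ) (A : DiffOp N) [hA : Smo A] : Smo (c • A) where
  out n i j := contDiff_const.mul (hA.out n i j)

instance smo_sub (A B : DiffOp N) [hA : Smo A] [hB : Smo B] : Smo (A - B) where
  out n i j := (hA.out n i j).sub (hB.out n i j)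

instance smo_dx (A : DiffOp N) [hA : Smo A] : Smo (dx A) where
  out n i j := (contDiff_infty_iff_deriv.1 (hA.out n i j)).2

instance smo_sh (θ : ℝ) (A : DiffOp N) [hA : Smo A] : Smo (sh θ A) where
  out n i j := (hA.out n i j).comp (contDiff_id.add contDiff_const)

instance smo_flip (A : DiffOp N) [hA : Smo A] : Smo (flip A) where
  out n i j := hA.out (-n) i j

instance smo_pow (ε : ℝ) (A : DiffOp N) [Lo A] [Up A] [Smo A] (n : ℕ) : Smo (pow ε A n) := by
  induction n with
  | zero => exact smo_one
  | succ n ih => exact smo_mul ε A _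

variable {T : ℝ}

instance per_mul (ε : ℝ) (A B : DiffOp N) [hA : Per T A] [hB : Per T B] :
    Per T (mul ε A B) where
  out n x := by
    unfold mul
    refine finsum_congr fun m => ?_
    rw [hA.out, show x + T + m * ε = x + m * ε + T by ring, hB.out]

instance per_mono (d : ℤ) (M : Matrix (Fin N) (Fin N) ℂ) : Per T (mono d M) where
  out _ _ := rfl

instance per_one : Per T (one : DiffOp N) := per_mono 0 1

instance per_add (A B : DiffOp N) [hA : Per T A] [hB : Per T B] : Per T (A + B) where
  out n x := congrArg₂ (· + ·) (hA.out n x) (hB.out n x)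

instance per_smul (c : ℂ) (A : DiffOp N) [hA : Per T A] : Per T (c • A) where
  out n x := congrArg (c • ·) (hA.out n x)

instance per_sub (A B : DiffOp N) [hA : Per T A] [hB : Per T B] : Per T (A - B) where
  out n x := congrArg₂ (· - ·) (hA.out n x) (hB.out n x)

instance per_sh (θ : ℝ) (A : DiffOp N) [hA : Per T A] : Per T (sh θ A) where
  out n x := by
    show A n (x + T + θ) = A n (x + θ)
    rw [show x + T + θ = x + θ + T by ring, hA.out]

instance per_flip (A : DiffOp N) [hA : Per T A] : Per T (flip A) where
  out n x := hA.out (-n) x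

instance per_pow (ε : ℝ) (A : DiffOp N) [Per T A] (n : ℕ) : Per T (pow ε A n) := by
  induction n with
  | zero => exact per_one
  | succ n ih => exact per_mul ε A _

theorem per_iff_sh (A : DiffOp N) : Per T A ↔ sh T A = A :=
  ⟨fun h => funext fun n => funext fun x => h.out n x,
    fun h => ⟨fun n x => congrFun (congrFun h n) x⟩⟩

/-! ### The derivation `dx` -/

theorem hasDerivAt_coeff (A : DiffOp N) [hA : Smo A] (n : ℤ) (x : ℝ) (i j : Fin N) :
    HasDerivAt (fun y => A n y i j) (dx A n x i j) x :=
  (((hA.out n i j).differentiable (by simp)) x).hasDerivAt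

theorem ne_zero_of_dx {A : DiffOp N} {n : ℤ} (h : dx A n ≠ 0) : A n ≠ 0 :=
  fun h0 => h (dx_eq_zero h0)

theorem dx_mul (ε : ℝ) (A B : DiffOp N) [MulOK A B] [Smo A] [Smo B] :
    dx (mul ε A B) = mul ε (dx A) B + mul ε A (dx B) := by
  funext n x
  ext i j
  show deriv (fun y => mul ε A B n y i j) x = mul ε (dx A) B n x i j + mul ε A (dx B) n x i j
  have h : (fun y => mul ε A B n y i j) =
      fun y => ∑ m ∈ supp A B n, ∑ k, A m y i k * B (n - m) (y + m * ε) k j :=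
    funext fun y => mul_apply_sum ε A B n _ (mem_supp A B n) y i j
  rw [h, mul_apply_sum ε (dx A) B n (supp A B n)
      (fun m h1 h2 => mem_supp A B n m (ne_zero_of_dx h1) h2),
    mul_apply_sum ε A (dx B) n (supp A B n)
      (fun m h1 h2 => mem_supp A B n m h1 (ne_zero_of_dx h2)), ← Finset.sum_add_distrib]
  simp only [← Finset.sum_add_distrib]
  refine (HasDerivAt.fun_sum fun m _ => HasDerivAt.fun_sum fun k _ => ?_).deriv
  exact (hasDerivAt_coeff A m x i k).mul
    ((hasDerivAt_coeff B (n - m) (x + m * ε) k j).comp_add_const x (m * ε))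

theorem dx_mono (d : ℤ) (M : Matrix (Fin N) (Fin N) ℂ) : dx (mono d M) = 0 := by
  funext n x; ext i j; simp [dx, mono]

theorem dx_one : dx (one : DiffOp N) = 0 := dx_mono 0 1

theorem sh_dx (θ : ℝ) (A : DiffOp N) : sh θ (dx A) = dx (sh θ A) := by
  funext n x; ext i j
  show deriv (fun y => A n y i j) (x + θ) = deriv (fun y => A n (y + θ) i j) x
  rw [deriv_comp_add_const (fun y => A n y i j)]

theorem sh_eq_of_dx_eq_zero (A : DiffOp N) [hA : Smo A] (h : dx A = 0) (θ : ℝ) : sh θ A = A := by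
  funext n x; ext i j
  refine is_const_of_deriv_eq_zero ((hA.out n i j).differentiable (by simp)) (fun y => ?_) _ _
  exact congrFun (congrFun (congrFun (congrFun h n) y) i) j

/-! ### The trace functional -/

/-- The integral over one period of the density `Tr Res A`. -/
def tint (T : ℝ) (A : DiffOp N) : ℂ := ∫ x in (0 : ℝ)..T, trRes A x

theorem trRes_contDiff (A : DiffOp N) [hA : Smo A] : ContDiff ℝ ∞ (trRes A) := by
  unfold trRes Matrix.trace
  exact ContDiff.sum fun i _ => hA.out 0 i i

theorem trRes_intervalIntegrable (A : DiffOp N) [hA : Smo A] (a b : ℝ) :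
    IntervalIntegrable (trRes A) MeasureTheory.volume a b :=
  (trRes_contDiff A).continuous.intervalIntegrable a b

theorem trRes_add (A B : DiffOp N) (x : ℝ) : trRes (A + B) x = trRes A x + trRes B x :=
  Matrix.trace_add _ _

theorem trRes_sub (A B : DiffOp N) (x : ℝ) : trRes (A - B) x = trRes A x - trRes B x :=
  Matrix.trace_sub _ _

theorem trRes_smul (c : ℂ) (A : DiffOp N) (x : ℝ) : trRes (c • A) x = c * trRes A x :=
  (Matrix.trace_smul c (A 0 x)).trans (smul_eq_mul _ _)

theorem tint_add (A B : DiffOp N) [Smo A] [Smo B] : tint T (A + B) = tint T A + tint T B := by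
  unfold tint
  simp only [trRes_add]
  exact intervalIntegral.integral_add (trRes_intervalIntegrable A 0 T)
    (trRes_intervalIntegrable B 0 T)

theorem tint_sub (A B : DiffOp N) [Smo A] [Smo B] : tint T (A - B) = tint T A - tint T B := by
  unfold tint
  simp only [trRes_sub]
  exact intervalIntegral.integral_sub (trRes_intervalIntegrable A 0 T)
    (trRes_intervalIntegrable B 0 T)

theorem tint_smul (c : ℂ) (A : DiffOp N) : tint T (c • A) = c * tint T A := by
  unfold tint
  simp only [trRes_smul]
  exact intervalIntegral.integral_const_mul _ _

theorem tint_zero : tint T (0 : DiffOp N) = 0 := by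
  simp [tint, trRes]

theorem tint_flip (A : DiffOp N) : tint T (flip A) = tint T A := rfl

theorem integral_periodic_comp_add (f : ℝ → ℂ) (hf : Function.Periodic f T) (θ : ℝ) :
    ∫ x in (0 : ℝ)..T, f (x + θ) = ∫ x in (0 : ℝ)..T, f x := by
  rw [intervalIntegral.integral_comp_add_right]
  have h := hf.intervalIntegral_add_eq θ 0
  rw [zero_add] at h ⊢
  rw [add_comm T θ, h]

theorem tint_sh (θ : ℝ) (A : DiffOp N) [hA : Per T A] : tint T (sh θ A) = tint T A :=
  integral_periodic_comp_add (trRes A) (fun x => congrArg Matrix.trace (hA.out 0 x)) θ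

/-- In degree `m` the two densities `Tr A_m(x) B_{-m}(x + mε)` and `Tr B_{-m}(x) A_m(x - mε)` differ
by a translation by `mε`, which an integral over a full period does not see. Periodicity of both
factors is essential. -/
theorem tint_mul_comm (ε : ℝ) (A B : DiffOp N) [MulOK A B] [hA : Smo A] [hB : Smo B]
    [pA : Per T A] [pB : Per T B] : tint T (mul ε A B) = tint T (mul ε B A) := by
  let g : ℤ → ℝ → ℂ := fun m x => (A m x * B (0 - m) (x + m * ε)).trace
  have hg : ∀ m, Function.Periodic (g m) T := fun m x => by
    simp only [g]
    rw [pA.out, show x + T + m * ε = x + m * ε + T by ring, pB.out]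
  have hgc : ∀ m, Continuous (g m) := fun m => by
    have : g m = fun x => ∑ i, ∑ k, A m x i k * B (0 - m) (x + m * ε) k i := by
      funext x; simp [g, Matrix.trace, Matrix.mul_apply]
    rw [this]
    refine continuous_finsetSum _ fun i _ => continuous_finsetSum _ fun k _ => ?_
    exact (hA.out m i k).continuous.mul ((hB.out (0 - m) k i).continuous.comp (by fun_prop))
  have h1 : ∀ x, trRes (mul ε A B) x = ∑ m ∈ supp A B 0, g m x := fun x => by
    simp only [trRes]; rw [mul_eq_sum_supp, Matrix.trace_sum]
  have h2 : ∀ x, trRes (mul ε B A) x = ∑ m ∈ supp A B 0, g m (x + -(m * ε)) := fun x => by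
    simp only [trRes]
    rw [mul_eq_sum ε B A 0 ((supp A B 0).map (Equiv.neg ℤ).toEmbedding), Matrix.trace_sum,
      Finset.sum_map]
    · refine Finset.sum_congr rfl fun m _ => ?_
      simp only [Equiv.coe_toEmbedding, Equiv.neg_apply, g]
      rw [Matrix.trace_mul_comm]
      congr 3
      · ring
      · push_cast; ring
      · ring
      · ring
    · intro m hm hm'
      refine Finset.mem_map.2 ⟨-m, mem_supp A B 0 _ (by simpa using hm') (by simpa using hm), ?_⟩
      simp
  unfold tint
  simp only [h1, h2]
  rw [intervalIntegral.integral_finsetSum fun m _ => (hgc m).intervalIntegrable _ _,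
    intervalIntegral.integral_finsetSum (f := fun m x => g m (x + -(m * ε))) fun m _ =>
      ((hgc m).comp (by fun_prop : Continuous fun x : ℝ => x + -(m * ε))).intervalIntegrable _ _]
  exact Finset.sum_congr rfl fun m _ => (integral_periodic_comp_add (g m) (hg m) _).symm

/-! ### Variations of traces of powers -/

/-- The variation of the `n`-th power of `A` when the variation of `A` is `δA`. -/
def dpow (ε : ℝ) (A δA : DiffOp N) : ℕ → DiffOp N
  | 0 => 0
  | n + 1 => mul ε δA (pow ε A n) + mul ε A (dpow ε A δA n)

instance lo_dpow (ε : ℝ) (A δA : DiffOp N) [Lo A] [Lo δA] (n : ℕ) : Lo (dpow ε A δA n) := by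
  induction n with
  | zero => exact lo_zero
  | succ n ih => exact lo_add _ _

instance up_dpow (ε : ℝ) (A δA : DiffOp N) [Up A] [Up δA] (n : ℕ) : Up (dpow ε A δA n) := by
  induction n with
  | zero => exact up_zero
  | succ n ih => exact up_add _ _

instance smo_zero : Smo (0 : DiffOp N) := ⟨fun _ _ _ => contDiff_const⟩
instance per_zero : Per T (0 : DiffOp N) := ⟨fun _ _ => rfl⟩

instance smo_dpow (ε : ℝ) (A δA : DiffOp N) [Lo A] [Lo δA] [Up A] [Up δA] [Smo A] [Smo δA]
    (n : ℕ) : Smo (dpow ε A δA n) := by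
  induction n with
  | zero => exact smo_zero
  | succ n ih => exact smo_add _ _

instance per_dpow (ε : ℝ) (A δA : DiffOp N) [Per T A] [Per T δA]
    (n : ℕ) : Per T (dpow ε A δA n) := by
  induction n with
  | zero => exact per_zero
  | succ n ih => exact per_add _ _

/-- By cyclicity each of the `n + 1` positions of `δL` contributes the same trace. The weight `Z` is
universally quantified because the induction replaces it by `Z L`. -/
theorem tint_dpow (ε : ℝ) (L δL : DiffOp N) [Lo L] [Lo δL] [Up L] [Up δL] [Smo L] [Smo δL]
    [Per T L] [Per T δL] (n : ℕ) : ∀ (Z : DiffOp N) [Smo Z] [Per T Z],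
    mul ε Z L = mul ε L Z →
    tint T (mul ε (dpow ε L δL (n + 1)) Z)
      = (n + 1) * tint T (mul ε (mul ε (pow ε L n) Z) δL) := by
  induction n with
  | zero =>
    intro Z _ _ hZ
    simp only [dpow, pow]
    rw [opmul_zero, add_zero, opmul_one, one_opmul, tint_mul_comm]
    simp
  | succ n ih =>
    intro Z _ _ hZ
    have hZL : mul ε (mul ε Z L) L = mul ε L (mul ε Z L) := by rw [hZ, opmul_assoc, hZ]
    have e1 : tint T (mul ε (mul ε L (dpow ε L δL (n + 1))) Z)
        = tint T (mul ε (dpow ε L δL (n + 1)) (mul ε Z L)) := by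
      rw [opmul_assoc, tint_mul_comm, opmul_assoc]
    have e2 : tint T (mul ε (mul ε δL (pow ε L (n + 1))) Z)
        = tint T (mul ε (mul ε (pow ε L (n + 1)) Z) δL) := by
      rw [opmul_assoc, tint_mul_comm]
    have e3 : mul ε (pow ε L n) (mul ε Z L) = mul ε (pow ε L (n + 1)) Z := by
      rw [hZ, ← opmul_assoc, pow_succ_right]
    rw [dpow, add_opmul, tint_add, e1, e2, ih _ hZL, e3]
    push_cast; ring

/-- The trace of `L^n` against the variation of an idempotent commuting with `L` vanishes. -/
theorem tint_idempotent (ε : ℝ) (L C δC : DiffOp N) [Lo L] [Up L] [Smo L] [Lo C] [Smo C] [Lo δC]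
    [Smo δC] [Per T L] [Per T C] [Per T δC] (hC : mul ε C C = C) (hCL : mul ε C L = mul ε L C)
    (hδ : δC = mul ε δC C + mul ε C δC) (n : ℕ) : tint T (mul ε δC (pow ε L n)) = 0 := by
  -- Multiplying `δC = δC C + C δC` by `C` on both sides gives `X = X + X` for `X = C δC C`.
  have hz : mul ε C (mul ε δC C) = 0 := by
    have h1 : mul ε C (mul ε δC C)
        = mul ε C (mul ε (mul ε δC C + mul ε C δC) C) := by rw [← hδ]
    rw [add_opmul, opmul_add, opmul_assoc ε δC C C, hC, ← opmul_assoc ε C (mul ε C δC) C,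
      ← opmul_assoc ε C C δC, hC, opmul_assoc ε C δC C] at h1
    exact left_eq_add.1 h1
  have hp := pow_commute ε L C hCL n
  -- Split off an extra factor `C = C C`, cycle it to the other end and move it past `L^n`: the
  -- product `C δC C` appears.
  have h3 : tint T (mul ε (mul ε C δC) (pow ε L n)) = 0 := by
    have e1 : mul ε (mul ε C δC) (pow ε L n)
        = mul ε C (mul ε (mul ε C δC) (pow ε L n)) := by
      rw [← opmul_assoc, ← opmul_assoc, hC]
    rw [e1, tint_mul_comm, opmul_assoc, ← hp, ← opmul_assoc, opmul_assoc ε C δC C, hz,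
      zero_opmul, tint_zero]
  have h4 : tint T (mul ε (mul ε δC C) (pow ε L n)) = 0 := by
    have e1 : mul ε (mul ε δC C) (pow ε L n)
        = mul ε (mul ε (mul ε δC C) (pow ε L n)) C := by
      rw [opmul_assoc, opmul_assoc, hp, opmul_assoc ε (pow ε L n) C C, hC]
    rw [e1, tint_mul_comm, ← opmul_assoc, hz, zero_opmul, tint_zero]
  rw [hδ, add_opmul, tint_add, h3, h4, add_zero]

/-! ### Functions of two real variables -/

theorem hasDerivAt_fst {f : ℝ × ℝ → ℂ} (hf : ContDiff ℝ ∞ f) (τ x : ℝ) :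
    HasDerivAt (fun t => f (t, x)) (fderiv ℝ f (τ, x) (1, 0)) τ := by
  have h1 := (hf.differentiable (by simp) (τ, x)).hasFDerivAt
  exact h1.comp_hasDerivAt τ ((hasDerivAt_id τ).prodMk (hasDerivAt_const τ x))

theorem hasDerivAt_snd {f : ℝ × ℝ → ℂ} (hf : ContDiff ℝ ∞ f) (τ x : ℝ) :
    HasDerivAt (fun y => f (τ, y)) (fderiv ℝ f (τ, x) (0, 1)) x := by
  have h1 := (hf.differentiable (by simp) (τ, x)).hasFDerivAt
  exact h1.comp_hasDerivAt x ((hasDerivAt_const x τ).prodMk (hasDerivAt_id x))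

theorem contDiff_fderiv_apply {f : ℝ × ℝ → ℂ} (hf : ContDiff ℝ ∞ f) (w : ℝ × ℝ) :
    ContDiff ℝ ∞ fun q => fderiv ℝ f q w :=
  (hf.fderiv_right (m := ∞) (by simp)).clm_apply contDiff_const

theorem contDiff_deriv_fst {f : ℝ × ℝ → ℂ} (hf : ContDiff ℝ ∞ f) :
    ContDiff ℝ ∞ fun q : ℝ × ℝ => deriv (fun t => f (t, q.2)) q.1 := by
  have h : (fun q : ℝ × ℝ => deriv (fun t => f (t, q.2)) q.1) = fun q => fderiv ℝ f q (1, 0) :=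
    funext fun q => (hasDerivAt_fst hf q.1 q.2).deriv
  rw [h]; exact contDiff_fderiv_apply hf _

theorem contDiff_deriv_snd {f : ℝ × ℝ → ℂ} (hf : ContDiff ℝ ∞ f) :
    ContDiff ℝ ∞ fun q : ℝ × ℝ => deriv (fun y => f (q.1, y)) q.2 := by
  have h : (fun q : ℝ × ℝ => deriv (fun y => f (q.1, y)) q.2) = fun q => fderiv ℝ f q (0, 1) :=
    funext fun q => (hasDerivAt_snd hf q.1 q.2).deriv
  rw [h]; exact contDiff_fderiv_apply hf _

theorem deriv_comm {f : ℝ × ℝ → ℂ} (hf : ContDiff ℝ ∞ f) (τ x : ℝ) :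
    deriv (fun t => deriv (fun y => f (t, y)) x) τ
      = deriv (fun y => deriv (fun t => f (t, y)) τ) x := by
  have h1 : (fun t => deriv (fun y => f (t, y)) x) = fun t => fderiv ℝ f (t, x) (0, 1) :=
    funext fun t => (hasDerivAt_snd hf t x).deriv
  have h2 : (fun y => deriv (fun t => f (t, y)) τ) = fun y => fderiv ℝ f (τ, y) (1, 0) :=
    funext fun y => (hasDerivAt_fst hf τ y).deriv
  have hd : DifferentiableAt ℝ (fderiv ℝ f) (τ, x) :=
    (hf.fderiv_right (m := ∞) (by simp)).differentiable (by simp) _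
  have hs : IsSymmSndFDerivAt ℝ f (τ, x) :=
    (hf.contDiffAt).isSymmSndFDerivAt (by
      rw [minSmoothness_of_isRCLikeNormedField]; exact WithTop.coe_le_coe.2 le_top)
  rw [h1, h2, (hasDerivAt_fst (contDiff_fderiv_apply hf _) τ x).deriv,
    (hasDerivAt_snd (contDiff_fderiv_apply hf _) τ x).deriv,
    fderiv_clm_apply hd (differentiableAt_const _), fderiv_clm_apply hd (differentiableAt_const _)]
  simpa using hs (1, 0) (0, 1)

theorem hasDerivAt_integral {f : ℝ × ℝ → ℂ} (hf : ContDiff ℝ ∞ f) (a b τ : ℝ) :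
    HasDerivAt (fun t => ∫ x in a..b, f (t, x))
      (∫ x in a..b, deriv (fun t => f (t, x)) τ) τ := by
  have hc := (contDiff_deriv_fst hf).continuous
  -- Continuity of the time derivative on a compact rectangle supplies a constant dominating
  -- function.
  obtain ⟨M, hM⟩ := ((isCompact_closedBall τ 1).prod (isCompact_uIcc (a := a) (b := b)))
    |>.exists_bound_of_continuousOn hc.continuousOn
  refine (intervalIntegral.hasDerivAt_integral_of_dominated_loc_of_deriv_le
    (F := fun t x => f (t, x)) (F' := fun t x => deriv (fun t => f (t, x)) t)
    (bound := fun _ => M) (Metric.ball_mem_nhds τ one_pos)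
    (Filter.Eventually.of_forall fun t =>
      (hf.continuous.comp (Continuous.prodMk_right t)).aestronglyMeasurable)
    ((hf.continuous.comp (Continuous.prodMk_right τ)).intervalIntegrable a b)
    (hc.comp (Continuous.prodMk_right τ)).aestronglyMeasurable
    (Filter.Eventually.of_forall fun x hx t ht =>
      hM (t, x) ⟨Metric.ball_subset_closedBall ht, Set.uIoc_subset_uIcc hx⟩)
    intervalIntegrable_const
    (Filter.Eventually.of_forall fun x _ t _ => ?_)).2
  have h := hasDerivAt_fst hf t x
  rw [h.deriv]; exact h

/-! ### Families of difference operators -/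

/-- Joint smoothness in the parameter and the space variable. -/
def JSm (A : ℝ → DiffOp N) : Prop :=
  ∀ (n : ℤ) (i j : Fin N), ContDiff ℝ ∞ (fun q : ℝ × ℝ => A q.1 n q.2 i j)

/-- Degree bounded above, uniformly in the parameter. -/
def FLo (A : ℝ → DiffOp N) : Prop := ∃ a, ∀ τ, DegLE a (A τ)

/-- Degree bounded below, uniformly in the parameter. -/
def FUp (A : ℝ → DiffOp N) : Prop := ∃ a, ∀ τ, DegGE a (A τ)

/-- Every coefficient of the product is a finite sum, uniformly in the parameter. -/
def FOK (A B : ℝ → DiffOp N) : Prop :=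
  ∀ n : ℤ, ∃ s : Finset ℤ, ∀ τ τ' m, A τ m ≠ 0 → B τ' (n - m) ≠ 0 → m ∈ s

/-- The derivative of a family with respect to the parameter. -/
def dt (A : ℝ → DiffOp N) (τ : ℝ) : DiffOp N :=
  fun n x => Matrix.of fun i j => deriv (fun t => A t n x i j) τ

section
variable {A B : ℝ → DiffOp N}

theorem FLo.lo (h : FLo A) (τ : ℝ) : Lo (A τ) := let ⟨a, ha⟩ := h; ⟨a, ha τ⟩
theorem FUp.up (h : FUp A) (τ : ℝ) : Up (A τ) := let ⟨a, ha⟩ := h; ⟨a, ha τ⟩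

theorem FLo.mul (ε : ℝ) (hA : FLo A) (hB : FLo B) : FLo fun τ => mul ε (A τ) (B τ) := by
  obtain ⟨a, ha⟩ := hA
  obtain ⟨b, hb⟩ := hB
  exact ⟨a + b, fun τ => (ha τ).mul ε (hb τ)⟩

theorem FUp.mul (ε : ℝ) (hA : FUp A) (hB : FUp B) : FUp fun τ => mul ε (A τ) (B τ) := by
  obtain ⟨a, ha⟩ := hA
  obtain ⟨b, hb⟩ := hB
  exact ⟨a + b, fun τ => (ha τ).mul ε (hb τ)⟩

theorem FLo.const (A : DiffOp N) [hA : Lo A] : FLo fun _ => A :=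
  let ⟨a, ha⟩ := hA.bdd; ⟨a, fun _ => ha⟩
theorem FUp.const (A : DiffOp N) [hA : Up A] : FUp fun _ => A :=
  let ⟨a, ha⟩ := hA.bdd; ⟨a, fun _ => ha⟩

theorem FLo.dx (hA : FLo A) : FLo fun τ => dx (A τ) := let ⟨a, ha⟩ := hA; ⟨a, fun τ => (ha τ).dx⟩
theorem FUp.dx (hA : FUp A) : FUp fun τ => dx (A τ) := let ⟨a, ha⟩ := hA; ⟨a, fun τ => (ha τ).dx⟩

theorem FUp.flip (hA : FUp A) : FLo fun τ => flip (A τ) :=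
  let ⟨a, ha⟩ := hA; ⟨-a, fun τ => (ha τ).flip⟩

theorem FLo.pow (ε : ℝ) (hA : FLo A) (n : ℕ) : FLo fun τ => pow ε (A τ) n := by
  induction n with
  | zero => exact FLo.const one
  | succ n ih => exact hA.mul ε ih

theorem FUp.pow (ε : ℝ) (hA : FUp A) (n : ℕ) : FUp fun τ => pow ε (A τ) n := by
  induction n with
  | zero => exact FUp.const one
  | succ n ih => exact hA.mul ε ih

theorem FOK.lo (hA : FLo A) (hB : FLo B) : FOK A B := by
  obtain ⟨a, ha⟩ := hA
  obtain ⟨b, hb⟩ := hB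
  refine fun n => ⟨Finset.Icc (n - b) a, fun τ τ' m h1 h2 => ?_⟩
  have := (ha τ).le h1
  have := (hb τ').le h2
  rw [Finset.mem_Icc]; omega

theorem FOK.up (hA : FUp A) (hB : FUp B) : FOK A B := by
  obtain ⟨a, ha⟩ := hA
  obtain ⟨b, hb⟩ := hB
  refine fun n => ⟨Finset.Icc a (n - b), fun τ τ' m h1 h2 => ?_⟩
  have := (ha τ).le h1
  have := (hb τ').le h2
  rw [Finset.mem_Icc]; omega

theorem FOK.fin (hA : FLo A) (hB : FUp A) : FOK A B := by
  obtain ⟨a, ha⟩ := hA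
  obtain ⟨b, hb⟩ := hB
  refine fun n => ⟨Finset.Icc b a, fun τ τ' m h1 h2 => ?_⟩
  have := (ha τ).le h1
  have := (hb τ).le h1
  rw [Finset.mem_Icc]; omega

theorem JSm.smo (hA : JSm A) (τ : ℝ) : Smo (A τ) :=
  ⟨fun n i j => (hA n i j).comp (contDiff_const.prodMk contDiff_id)⟩

theorem JSm.const (A : DiffOp N) [hA : Smo A] : JSm fun _ => A :=
  fun n i j => (hA.out n i j).comp contDiff_snd

theorem JSm.add (hA : JSm A) (hB : JSm B) : JSm fun τ => A τ + B τ :=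
  fun n i j => (hA n i j).add (hB n i j)

theorem JSm.sub (hA : JSm A) (hB : JSm B) : JSm fun τ => A τ - B τ :=
  fun n i j => (hA n i j).sub (hB n i j)

theorem JSm.smul (c : ℂ) (hA : JSm A) : JSm fun τ => c • A τ :=
  fun n i j => contDiff_const.mul (hA n i j)

theorem JSm.dx (hA : JSm A) : JSm fun τ => dx (A τ) :=
  fun n i j => contDiff_deriv_snd (hA n i j)

theorem JSm.flip (hA : JSm A) : JSm fun τ => flip (A τ) := fun n i j => hA (-n) i j

theorem JSm.mul (ε : ℝ) (hA : JSm A) (hB : JSm B) (hAB : FOK A B) :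
    JSm fun τ => mul ε (A τ) (B τ) := by
  intro n i j
  obtain ⟨s, hs⟩ := hAB n
  have h : (fun q : ℝ × ℝ => EMTH.mul ε (A q.1) (B q.1) n q.2 i j) =
      fun q => ∑ m ∈ s, ∑ k, A q.1 m q.2 i k * B q.1 (n - m) (q.2 + m * ε) k j :=
    funext fun q => mul_apply_sum ε _ _ n s (hs q.1 q.1) q.2 i j
  rw [h]
  refine ContDiff.sum fun m _ => ContDiff.sum fun k _ => ?_
  exact (hA m i k).mul ((hB (n - m) k j).comp
    (contDiff_fst.prodMk (contDiff_snd.add contDiff_const)))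

theorem JSm.pow (ε : ℝ) (hA : JSm A) (h1 : FLo A) (h2 : FUp A) (n : ℕ) :
    JSm fun τ => pow ε (A τ) n := by
  induction n with
  | zero => exact JSm.const one
  | succ n ih => exact hA.mul ε ih (FOK.fin h1 h2)

theorem JSm.hasDerivAt (hA : JSm A) (τ : ℝ) (n : ℤ) (x : ℝ) (i j : Fin N) :
    HasDerivAt (fun t => A t n x i j) (dt A τ n x i j) τ := by
  have h := hasDerivAt_fst (hA n i j) τ x
  have h2 : dt A τ n x i j = _ := h.deriv
  rw [h2]; exact h

theorem JSm.dt (hA : JSm A) : JSm (dt A) := fun n i j => contDiff_deriv_fst (hA n i j)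

theorem dt_apply_eq_zero {n : ℤ} (h : ∀ τ, A τ n = 0) (τ : ℝ) : dt A τ n = 0 := by
  funext x; ext i j; simp [EMTH.dt, h]

theorem FLo.dt (hA : FLo A) : FLo (dt A) :=
  let ⟨a, ha⟩ := hA; ⟨a, fun τ n hn => dt_apply_eq_zero (fun t => ha t n hn) τ⟩
theorem FUp.dt (hA : FUp A) : FUp (dt A) :=
  let ⟨a, ha⟩ := hA; ⟨a, fun τ n hn => dt_apply_eq_zero (fun t => ha t n hn) τ⟩

theorem dt_const (A : DiffOp N) (τ : ℝ) : dt (fun _ => A) τ = 0 := by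
  funext n x; ext i j; simp [dt]

theorem dt_add (hA : JSm A) (hB : JSm B) (τ : ℝ) :
    dt (fun t => A t + B t) τ = dt A τ + dt B τ := by
  funext n x; ext i j
  exact ((hA.hasDerivAt τ n x i j).add (hB.hasDerivAt τ n x i j)).deriv

theorem dt_sub (hA : JSm A) (hB : JSm B) (τ : ℝ) :
    dt (fun t => A t - B t) τ = dt A τ - dt B τ := by
  funext n x; ext i j
  exact ((hA.hasDerivAt τ n x i j).sub (hB.hasDerivAt τ n x i j)).deriv

theorem dt_smul (c : ℂ) (hA : JSm A) (τ : ℝ) : dt (fun t => c • A t) τ = c • dt A τ := by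
  funext n x; ext i j
  exact ((hA.hasDerivAt τ n x i j).const_mul c).deriv

theorem dt_dx (hA : JSm A) (τ : ℝ) : dt (fun t => dx (A t)) τ = dx (dt A τ) := by
  funext n x; ext i j
  exact deriv_comm (hA n i j) τ x

theorem dt_flip (A : ℝ → DiffOp N) (τ : ℝ) : dt (fun t => flip (A t)) τ = flip (dt A τ) := rfl

theorem dt_per {T : ℝ} (hA : ∀ t, Per T (A t)) (τ : ℝ) : Per T (dt A τ) where
  out n x := by ext i j; simp only [dt, Matrix.of_apply, (hA _).out n x]

theorem dt_mul (ε : ℝ) (hA : JSm A) (hB : JSm B) (hAB : FOK A B) (τ : ℝ) :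
    dt (fun t => mul ε (A t) (B t)) τ = mul ε (dt A τ) (B τ) + mul ε (A τ) (dt B τ) := by
  funext n x; ext i j
  obtain ⟨s, hs⟩ := hAB n
  -- A nonzero time derivative at `τ` only shows that the coefficient is nonzero at some time,
  -- perhaps another one. This is why `FOK` lets its two parameters vary independently.
  have hne : ∀ {F : ℝ → DiffOp N} {m : ℤ}, dt F τ m ≠ 0 → ∃ t, F t m ≠ 0 := fun h => by
    by_contra! hc; exact h (dt_apply_eq_zero hc τ)
  have h : (fun t => mul ε (A t) (B t) n x i j) =
      fun t => ∑ m ∈ s, ∑ k, A t m x i k * B t (n - m) (x + m * ε) k j :=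
    funext fun t => mul_apply_sum ε _ _ n s (hs t t) x i j
  show deriv (fun t => mul ε (A t) (B t) n x i j) τ
    = mul ε (dt A τ) (B τ) n x i j + mul ε (A τ) (dt B τ) n x i j
  rw [h, mul_apply_sum ε (dt A τ) (B τ) n s
      (fun m h1 h2 => let ⟨t, ht⟩ := hne h1; hs t τ m ht h2),
    mul_apply_sum ε (A τ) (dt B τ) n s
      (fun m h1 h2 => let ⟨t, ht⟩ := hne h2; hs τ t m h1 ht), ← Finset.sum_add_distrib]
  simp only [← Finset.sum_add_distrib]
  exact (HasDerivAt.fun_sum fun m _ => HasDerivAt.fun_sum fun k _ =>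
    (hA.hasDerivAt τ m x i k).mul (hB.hasDerivAt τ (n - m) (x + m * ε) k j)).deriv

theorem dt_pow (ε : ℝ) (hA : JSm A) (h1 : FLo A) (h2 : FUp A) (τ : ℝ) (n : ℕ) :
    dt (fun t => pow ε (A t) n) τ = dpow ε (A τ) (dt A τ) n := by
  induction n with
  | zero => exact dt_const one τ
  | succ n ih =>
    have h := dt_mul ε hA (hA.pow ε h1 h2 n) (FOK.fin h1 h2) τ
    rw [ih] at h
    exact h

theorem hasDerivAt_tint (T : ℝ) (hA : JSm A) (τ : ℝ) :
    HasDerivAt (fun t => tint T (A t)) (tint T (dt A τ)) τ := by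
  have hf : ContDiff ℝ ∞ fun q : ℝ × ℝ => trRes (A q.1) q.2 := by
    unfold trRes Matrix.trace
    exact ContDiff.sum fun i _ => hA 0 i i
  have h := hasDerivAt_integral hf 0 T τ
  have h2 : ∀ x, deriv (fun t => trRes (A t) x) τ = trRes (dt A τ) x := fun x => by
    unfold trRes Matrix.trace
    exact (HasDerivAt.fun_sum fun i _ => hA.hasDerivAt τ 0 x i i).deriv
  simp only [h2] at h
  exact h
end

/-- A right inverse of a smooth family of degree at most zero is again a smooth family. -/
theorem JSm.inv (ε : ℝ) {S Si : ℝ → DiffOp N} (hS : JSm S) (h1 : ∀ τ, DegLE 0 (S τ))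
    (h2 : ∀ τ, DegLE 0 (Si τ)) (h3 : ∀ τ, EMTH.mul ε (S τ) (Si τ) = one) : JSm Si := by
  -- Isolate the term of the product containing the coefficient of degree `-n` of the inverse; the
  -- remaining terms involve only its coefficients of degrees `0, …, -(n-1)`.
  have hcoef : ∀ (n : ℕ) τ x, EMTH.mul ε (S τ) (Si τ) (-(n : ℤ)) x
      = S τ 0 x * Si τ (-(n : ℤ)) x
        + ∑ m ∈ Finset.range n, S τ (-((m : ℤ) + 1)) x
          * Si τ (-((n - 1 - m : ℕ) : ℤ)) (x + (-((m : ℤ) + 1) : ℤ) * ε) := by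
    intro n τ x
    rw [mul_eq_sum ε _ _ _ ((Finset.range (n + 1)).image fun m : ℕ => -(m : ℤ)), Finset.sum_image,
      Finset.sum_range_succ']
    · rw [add_comm]
      congr 1
      · simp
      · refine Finset.sum_congr rfl fun m hm => ?_
        have hm' := Finset.mem_range.1 hm
        push_cast
        rw [show -(n : ℤ) - -((m : ℤ) + 1) = -((n - 1 - m : ℕ) : ℤ) by omega]
    · intro a _ b _ h; simpa using h
    · intro m hm hm'
      have ha := (h1 τ).le hm
      have hb := (h2 τ).le hm'
      exact Finset.mem_image.2 ⟨m.natAbs, Finset.mem_range.2 (by omega), by omega⟩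
  have hlead : ∀ τ x, S τ 0 x * Si τ 0 x = 1 := fun τ x => by
    have h := hcoef 0 τ x
    rw [h3] at h
    simpa [one, mono] using h.symm
  -- Cramer's formula makes the leading coefficient of the inverse a smooth function of that of `S`.
  have hinv : ∀ τ x, Si τ 0 x = ((S τ 0 x).det)⁻¹ • (S τ 0 x).adjugate := fun τ x => by
    have hdet : (S τ 0 x).det * (Si τ 0 x).det = 1 := by
      rw [← Matrix.det_mul, hlead, Matrix.det_one]
    have h := Matrix.adjugate_mul (S τ 0 x)
    calc Si τ 0 x = ((S τ 0 x).det)⁻¹ • ((S τ 0 x).det • Si τ 0 x) := by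
          rw [smul_smul, inv_mul_cancel₀ (left_ne_zero_of_mul_eq_one hdet), one_smul]
      _ = ((S τ 0 x).det)⁻¹ • ((S τ 0 x).adjugate * (S τ 0 x) * Si τ 0 x) := by
          rw [h, smul_mul_assoc, one_mul]
      _ = _ := by rw [mul_assoc, hlead, mul_one]
  have hdetS : ∀ {k : ℕ} (M : ℝ × ℝ → Matrix (Fin k) (Fin k) ℂ),
      (∀ i j, ContDiff ℝ ∞ fun q => M q i j) → ContDiff ℝ ∞ fun q => (M q).det := by
    intro k M hM
    simp only [Matrix.det_apply']
    exact ContDiff.sum fun σ _ => contDiff_const.mul (contDiff_prod fun i _ => hM _ _)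
  have h0 : ∀ i j, ContDiff ℝ ∞ fun q : ℝ × ℝ => Si q.1 0 q.2 i j := by
    intro i j
    simp only [hinv, Matrix.smul_apply, smul_eq_mul]
    refine ((hdetS (fun q : ℝ × ℝ => S q.1 0 q.2) (hS 0)).inv fun q => ?_).mul ?_
    · have hdet : (S q.1 0 q.2).det * (Si q.1 0 q.2).det = 1 := by
        rw [← Matrix.det_mul, hlead, Matrix.det_one]
      exact left_ne_zero_of_mul_eq_one hdet
    · simp only [Matrix.adjugate_apply]
      refine hdetS (fun q : ℝ × ℝ => (S q.1 0 q.2).updateRow j (Pi.single i 1)) fun a b => ?_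
      by_cases hab : a = j
      · subst hab; simp only [Matrix.updateRow_self]; exact contDiff_const
      · simp only [Matrix.updateRow_ne hab]; exact hS 0 a b
  have hlead' : ∀ τ x, Si τ 0 x * S τ 0 x = 1 := fun τ x => mul_eq_one_comm.1 (hlead τ x)
  have key : ∀ n : ℕ, ∀ i j, ContDiff ℝ ∞ fun q : ℝ × ℝ => Si q.1 (-(n : ℤ)) q.2 i j := by
    intro n
    induction n using Nat.strong_induction_on with
    | _ n ih =>
      rcases Nat.eq_zero_or_pos n with rfl | hn
      · simpa using h0
      intro i j
      have hrec : ∀ τ x, Si τ (-(n : ℤ)) x = -(Si τ 0 x *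
          ∑ m ∈ Finset.range n, S τ (-((m : ℤ) + 1)) x
          * Si τ (-((n - 1 - m : ℕ) : ℤ)) (x + (-((m : ℤ) + 1) : ℤ) * ε)) := by
        intro τ x
        have h := hcoef n τ x
        rw [h3] at h
        have hz : (one : DiffOp N) (-(n : ℤ)) x = 0 := by
          simp only [one, mono]; rw [if_neg (by omega)]
        rw [hz] at h
        have h5 := congrArg (Si τ 0 x * ·) h
        simp only [mul_zero, mul_add, ← mul_assoc, hlead', one_mul] at h5
        rw [eq_neg_iff_add_eq_zero]
        exact h5.symm
      simp only [hrec, Matrix.neg_apply, Matrix.mul_apply, Matrix.sum_apply]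
      refine ContDiff.neg (ContDiff.sum fun k _ => (h0 i k).mul (ContDiff.sum fun m hm =>
        ContDiff.sum fun l _ => (hS _ _ _).mul ?_))
      exact (ih (n - 1 - m) (by omega) l j).comp
        (contDiff_fst.prodMk (contDiff_snd.add contDiff_const))
  intro n i j
  rcases le_or_gt n 0 with hn | hn
  · obtain ⟨k, rfl⟩ : ∃ k : ℕ, n = -(k : ℤ) := ⟨n.natAbs, by omega⟩
    exact key k i j
  · have : (fun q : ℝ × ℝ => Si q.1 n q.2 i j) = fun _ => 0 := by
      funext q; rw [h2 q.1 n hn]; rfl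
    rw [this]; exact contDiff_const

/-! ### The variation of the logarithm of a dressed shift -/

theorem mono_mul_mono_mul (ε : ℝ) (d e : ℤ) (M M' : Matrix (Fin N) (Fin N) ℂ) (X : DiffOp N) :
    mul ε (mono d M) (mul ε (mono e M') X) = mul ε (mono (d + e) (M * M')) X := by
  rw [← opmul_assoc, mono_mul_mono]

theorem cancel_left {ε : ℝ} {S Si : DiffOp N} [Lo S] [Lo Si]
    (h : mul ε S Si = one) (X : DiffOp N) [Lo X] :
    mul ε S (mul ε Si X) = X := by
  rw [← opmul_assoc, h, one_opmul]

theorem pow_conj {ε : ℝ} {S Si : DiffOp N} [Lo S] [Lo Si] (h1 : mul ε S Si = one)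
    (h2 : mul ε Si S = one) (M : Matrix (Fin N) (Fin N) ℂ) (d : ℤ) (n : ℕ) :
    pow ε (mul ε S (mul ε (mono d M) Si)) n
      = mul ε S (mul ε (mono (n * d) (M ^ n)) Si) := by
  induction n with
  | zero => simp only [pow, Nat.cast_zero, zero_mul, pow_zero]; rw [← one, one_opmul, h1]
  | succ n ih =>
    rw [pow, ih, opmul_assoc, opmul_assoc, cancel_left h2, mono_mul_mono_mul, ← pow_succ']
    congr 3; push_cast; ring

section
variable {ε T : ℝ} {S Si : DiffOp N} [Lo S] [Lo Si] [Smo S] [Smo Si]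

theorem dx_inv (h1 : mul ε S Si = one) (h2 : mul ε Si S = one) :
    dx Si = -mul ε Si (mul ε (dx S) Si) := by
  have h3 : mul ε (dx S) Si + mul ε S (dx Si) = 0 := by rw [← dx_mul, h1, dx_one]
  have h4 : mul ε Si (mul ε (dx S) Si + mul ε S (dx Si)) = 0 := by rw [h3, opmul_zero]
  rw [opmul_add, cancel_left h2] at h4
  rw [eq_neg_iff_add_eq_zero, add_comm, h4]

/-- Periodicity of `S_x S⁻¹` makes `S` quasi-periodic: `S(x+T) = S(x) K` with an operator `K`
constant in `x`. Translation by `θ` leaves `K` unchanged, so `K` cancels in `S(x) S(x+θ)⁻¹`. -/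
theorem per_mul_sh_inv (h1 : mul ε S Si = one) (h2 : mul ε Si S = one)
    [hY : Per T (mul ε (dx S) Si)] (θ : ℝ) : Per T (mul ε S (sh θ Si)) := by
  have s1 : mul ε (sh T S) (sh T Si) = one := by rw [← sh_mul, h1]; rfl
  have hX : sh T (dx S) = mul ε (mul ε (dx S) Si) (sh T S) := by
    have h := (per_iff_sh _).1 hY
    have s2 : mul ε (sh T Si) (sh T S) = one := by rw [← sh_mul, h2]; rfl
    rw [← h, sh_mul, opmul_assoc, s2, opmul_one]
  -- `S` and its translate by `T` solve the same linear equation `X_x = Y X`, so their quotient is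
  -- constant.
  have hK : dx (mul ε Si (sh T S)) = 0 := by
    rw [dx_mul, dx_inv h1 h2, ← sh_dx, hX, neg_opmul]
    simp only [opmul_assoc]
    exact neg_add_cancel _
  have hKθ := sh_eq_of_dx_eq_zero _ hK θ
  have hS : sh T S = mul ε S (mul ε Si (sh T S)) := (cancel_left h1 _).symm
  rw [per_iff_sh, sh_mul]
  have hKi : mul ε (mul ε Si (sh T S)) (sh θ (sh T Si)) = sh θ Si := by
    conv_lhs => rw [← hKθ]
    rw [← sh_mul, opmul_assoc, s1, opmul_one]
  have hc : sh T (sh θ Si) = sh θ (sh T Si) := by rw [sh_sh, sh_sh, add_comm]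
  rw [hc, hS, opmul_assoc, hKi]

/-- The right side does not involve `θ`. Insert translated copies of `S` and `S⁻¹` around the
translated middle factor: the product breaks into factors that are periodic although `S` is not.
Cycling them makes the whole operator a translate by `θ`. -/
theorem tint_conj_sh (h1 : mul ε S Si = one) (h2 : mul ε Si S = one) (m' : DiffOp N) [Lo m']
    [Smo m'] [Per T (mul ε (dx S) Si)] (hL : Per T (mul ε S (mul ε (mono 1 1) Si)))
    (hZ : Per T (mul ε S (mul ε m' Si))) (n : ℕ) (θ : ℝ) :
    tint T (mul ε (mul ε S (mono n 1)) (mul ε (sh θ m') (mul ε (mono 1 1) Si)))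
      = tint T (mul ε (mul ε S (mul ε m' Si)) (mul ε S (mul ε (mono (n + 1 : ℕ) 1) Si))) := by
  have s2 : mul ε (sh θ Si) (sh θ S) = one := by rw [← sh_mul, h2]; rfl
  set Z := mul ε S (mul ε m' Si) with hZdef
  have hm : sh θ m' = mul ε (sh θ Si) (mul ε (sh θ Z) (sh θ S)) := by
    rw [← sh_mul, ← sh_mul, hZdef]
    rw [opmul_assoc, opmul_assoc, h2, opmul_one, cancel_left h2]
  have hUV : mul ε (mul ε S (mono n 1)) (mul ε (sh θ m') (mul ε (mono 1 1) Si))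
      = mul ε (mul ε S (mul ε (mono n 1) (sh θ Si)))
          (mul ε (sh θ Z) (mul ε (sh θ S) (mul ε (mono 1 1) Si))) := by
    rw [hm]; simp only [opmul_assoc]
  have pL : Per T (mul ε S (mul ε (mono n 1) Si)) := by
    have h := pow_conj h1 h2 (1 : Matrix (Fin N) (Fin N) ℂ) 1 n
    rw [one_pow, mul_one] at h
    rw [← h]; exact per_pow ε _ n
  have pU : Per T (mul ε S (mul ε (mono n 1) (sh θ Si))) := by
    have h : mul ε S (mul ε (mono n 1) (sh θ Si))
        = mul ε (mul ε S (mul ε (mono n 1) Si)) (mul ε S (sh θ Si)) := by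
      simp only [opmul_assoc]; rw [cancel_left h2]
    have := per_mul_sh_inv (T := T) h1 h2 θ
    rw [h]; infer_instance
  -- Moving `Λ` to the right translates `S⁻¹` by `ε`; relative to `S`, already translated by `θ`,
  -- the offset is `ε - θ`.
  have pV : Per T (mul ε (sh θ S) (mul ε (mono 1 1) Si)) := by
    have := per_mul_sh_inv (T := T) h1 h2 (ε - θ)
    have h : mul ε (sh θ S) (mul ε (mono 1 1) Si)
        = mul ε (sh θ (mul ε S (sh (ε - θ) Si))) (mono 1 1) := by
      rw [mono_mul_eq_sh, sh_mul, sh_sh, add_sub_cancel, opmul_assoc]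
    rw [h]; infer_instance
  have hVU : mul ε (mul ε (sh θ Z) (mul ε (sh θ S) (mul ε (mono 1 1) Si)))
        (mul ε S (mul ε (mono n 1) (sh θ Si)))
      = sh θ (mul ε Z (mul ε S (mul ε (mono (n + 1 : ℕ) 1) Si))) := by
    simp only [sh_mul, sh_mono, opmul_assoc]
    rw [cancel_left h2, mono_mul_mono_mul, one_mul, Nat.cast_succ, add_comm]
  have pT : Per T (mul ε S (mul ε (mono (n + 1 : ℕ) 1) Si)) := by
    have h := pow_conj h1 h2 (1 : Matrix (Fin N) (Fin N) ℂ) 1 (n + 1)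
    rw [one_pow, mul_one] at h
    rw [← h]; exact per_pow ε _ _
  rw [hUV, tint_mul_comm, hVU, tint_sh]

/-- This replaces the cyclic identity that would fail for non-periodic `S`: the finite difference of
`m` under `Λ` is the integral of its derivative along translations, and the integrand is constant by
`tint_conj_sh`. -/
theorem tint_conj_commutator (h1 : mul ε S Si = one) (h2 : mul ε Si S = one) (m : DiffOp N)
    [Lo m] [Smo m] [Per T (mul ε (dx S) Si)] (hL : Per T (mul ε S (mul ε (mono 1 1) Si)))
    (hZ : Per T (mul ε S (mul ε (dx m) Si))) (n : ℕ) :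
    tint T (mul ε (mul ε S (mono (n + 1 : ℕ) 1)) (mul ε m Si))
        - tint T (mul ε (mul ε S (mono n 1)) (mul ε m (mul ε (mono 1 1) Si)))
      = ε * tint T (mul ε (mul ε S (mul ε (dx m) Si))
          (mul ε S (mul ε (mono (n + 1 : ℕ) 1) Si))) := by
  set c := tint T (mul ε (mul ε S (mul ε (dx m) Si))
          (mul ε S (mul ε (mono (n + 1 : ℕ) 1) Si))) with hc
  set P := mul ε S (mono n 1)
  set Q := mul ε (mono 1 1) Si
  -- The family joins `m` at `s = 0` to `Λ m Λ⁻¹` at `s = 1`.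
  let A : ℝ → DiffOp N := fun s => sh (s * ε) m
  have fm : FLo A := by
    obtain ⟨a, ha⟩ := (inferInstance : Lo m).bdd
    exact ⟨a, fun s n hn => by funext x; simp [A, sh, ha n hn]⟩
  have jm : JSm A := fun n i j => ((inferInstance : Smo m).out n i j).comp
    (contDiff_snd.add (contDiff_fst.mul contDiff_const))
  have hdt : ∀ s, dt A s = (ε : ℂ) • sh (s * ε) (dx m) := fun s => by
    funext n x; ext i j
    have h := hasDerivAt_coeff m n (x + s * ε) i j
    have h2 : HasDerivAt (fun s : ℝ => x + s * ε) ε s := by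
      simpa using ((hasDerivAt_id s).mul_const ε).const_add x
    have h3 := (h.scomp s h2).deriv
    rw [Complex.real_smul] at h3
    exact h3
  have jAQ : JSm fun s => mul ε (A s) Q := jm.mul ε (JSm.const Q) (FOK.lo fm (FLo.const Q))
  have fAQ : FLo fun s => mul ε (A s) Q := fm.mul ε (FLo.const Q)
  have jPAQ : JSm fun s => mul ε P (mul ε (A s) Q) :=
    (JSm.const P).mul ε jAQ (FOK.lo (FLo.const P) fAQ)
  -- The trace has the constant speed `ε c`; after subtracting this linear function it suffices to
  -- compare the values at 1 and 0.
  have hΦ : ∀ s, HasDerivAt (fun s => tint T (mul ε P (mul ε (A s) Q)) - s * (ε * c)) 0 s := by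
    intro s
    have h := hasDerivAt_tint T jPAQ s
    rw [dt_mul ε (JSm.const P) jAQ (FOK.lo (FLo.const P) fAQ),
      dt_mul ε jm (JSm.const Q) (FOK.lo fm (FLo.const Q)), dt_const, dt_const, zero_opmul,
      opmul_zero, zero_add, add_zero, hdt, smul_opmul, opmul_smul, tint_smul,
      tint_conj_sh h1 h2 (dx m) hL hZ n, ← hc] at h
    have h4 : HasDerivAt (fun s : ℝ => (s : ℂ) * (ε * c)) (ε * c) s := by
      simpa using (Complex.ofRealCLM.hasDerivAt (x := s)).mul_const ((ε : ℂ) * c)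
    have h5 := h.sub h4
    rw [sub_self] at h5
    exact h5
  have hconst := is_const_of_deriv_eq_zero (fun s => (hΦ s).differentiableAt)
    (fun s => (hΦ s).deriv) 1 0
  have e1 : mul ε P (mul ε (A 1) Q) = mul ε (mul ε S (mono (n + 1 : ℕ) 1)) (mul ε m Si) := by
    simp only [A, one_mul, P, Q]
    rw [← opmul_assoc ε (sh ε m), ← mono_mul_eq_sh]
    simp only [opmul_assoc]
    rw [mono_mul_mono_mul, one_mul, Nat.cast_succ]
  have e0 : A 0 = m := by simp only [A, zero_mul]; exact sh_zero m
  simp only [e1, e0, Complex.ofReal_one, Complex.ofReal_zero, one_mul, zero_mul, sub_zero]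
    at hconst
  rw [← hconst]; ring
theorem dx_conj (h1 : mul ε S Si = one) (h2 : mul ε Si S = one) (d : ℤ) :
    dx (mul ε S (mul ε (mono d 1) Si))
      = mul ε (mul ε (dx S) Si) (mul ε S (mul ε (mono d 1) Si))
        - mul ε (mul ε S (mul ε (mono d 1) Si)) (mul ε (dx S) Si) := by
  rw [dx_mul, dx_mul, dx_mono, zero_opmul, zero_add, dx_inv h1 h2, opmul_neg, opmul_neg,
    ← sub_eq_add_neg]
  simp only [opmul_assoc]
  rw [cancel_left h2]
end

/-- For a smooth family of dressing operators `S`, with `L = S Λ S⁻¹`, the variation of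
`log L = ε∂ - ε S_x S⁻¹` satisfies `∫ Tr Res L^(n+1) δ(log L) = ∫ Tr Res L^n δL`. -/
theorem tint_pow_dt_log {ε T : ℝ} {S Si L : ℝ → DiffOp N} (jS : JSm S) (jSi : JSm Si) (fS : FLo S)
    (fSi : FLo Si) (h1 : ∀ τ, mul ε (S τ) (Si τ) = one) (h2 : ∀ τ, mul ε (Si τ) (S τ) = one)
    (hL : ∀ τ, L τ = mul ε (S τ) (mul ε (mono 1 1) (Si τ))) (pL : ∀ τ, Per T (L τ))
    (pY : ∀ τ, Per T (mul ε (dx (S τ)) (Si τ))) (τ : ℝ) (n : ℕ) :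
    tint T (mul ε (pow ε (L τ) (n + 1)) (dt (fun t => -(ε : ℂ) • mul ε (dx (S t)) (Si t)) τ))
      = tint T (mul ε (pow ε (L τ) n) (dt L τ)) := by
  have := fS.lo τ
  have := fSi.lo τ
  have := jS.smo τ
  have := jSi.smo τ
  have := fS.dt.lo τ
  have := fSi.dt.lo τ
  have := jS.dt.smo τ
  have := jSi.dt.smo τ
  have := pY τ
  have okSS := FOK.lo fS fSi
  -- In terms of the logarithmic variation `m = S⁻¹ δS` one has `δL = S (mΛ - Λm) S⁻¹` and `δ(S_x
  -- S⁻¹) = S m_x S⁻¹`.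
  set m := mul ε (Si τ) (dt S τ) with hm
  have hδS : dt S τ = mul ε (S τ) m := (cancel_left (h1 τ) _).symm
  have hδSi : dt Si τ = -mul ε m (Si τ) := by
    have h3 := dt_mul ε jS jSi okSS τ
    simp only [h1] at h3
    rw [dt_const] at h3
    have h4 : mul ε (Si τ) (mul ε (dt S τ) (Si τ) + mul ε (S τ) (dt Si τ)) = 0 := by
      rw [← h3, opmul_zero]
    rw [opmul_add, cancel_left (h2 τ)] at h4
    rw [eq_neg_iff_add_eq_zero, add_comm, hm, opmul_assoc, h4]
  have fΛSi : FLo fun t => mul ε (mono 1 1) (Si t) := (FLo.const (mono 1 1)).mul ε fSi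
  have okΛ := FOK.lo (FLo.const (mono 1 1)) fSi
  have jΛSi : JSm fun t => mul ε (mono 1 1) (Si t) := (JSm.const (mono 1 1)).mul ε jSi okΛ
  have hδL : dt L τ = mul ε (mul ε (S τ) m) (mul ε (mono 1 1) (Si τ))
      - mul ε (S τ) (mul ε (mono 1 1) (mul ε m (Si τ))) := by
    rw [show L = fun t => mul ε (S t) (mul ε (mono 1 1) (Si t)) from funext hL,
      dt_mul ε jS jΛSi (FOK.lo fS fΛSi), dt_mul ε (JSm.const (mono 1 1)) jSi okΛ, dt_const,
      zero_opmul, zero_add, hδS, hδSi, opmul_neg, opmul_neg, sub_eq_add_neg]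
  have okX := FOK.lo fS.dx fSi
  have jX : JSm fun t => mul ε (dx (S t)) (Si t) := jS.dx.mul ε jSi okX
  have hδX : dt (fun t => mul ε (dx (S t)) (Si t)) τ = mul ε (S τ) (mul ε (dx m) (Si τ)) := by
    rw [dt_mul ε jS.dx jSi okX, dt_dx jS, hδS, hδSi, dx_mul, add_opmul, opmul_neg, opmul_assoc,
      opmul_assoc, add_comm, ← add_assoc, neg_add_cancel, zero_add, opmul_assoc]
  -- Neither `S` nor `m` need be periodic; the conjugate is, being the time derivative of a family
  -- of periodic operators.
  have pδX : Per T (mul ε (S τ) (mul ε (dx m) (Si τ))) := hδX ▸ dt_per pY τ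
  have pLτ : Per T (mul ε (S τ) (mul ε (mono 1 1) (Si τ))) := hL τ ▸ pL τ
  have hpow : ∀ k : ℕ, pow ε (L τ) k = mul ε (S τ) (mul ε (mono k 1) (Si τ)) := fun k => by
    rw [hL, pow_conj (h1 τ) (h2 τ), one_pow, mul_one]
  have pk : ∀ k : ℕ, Per T (mul ε (S τ) (mul ε (mono k 1) (Si τ))) := fun k => by
    rw [← hpow, hL]; exact per_pow ε _ k
  have := pk (n + 1)
  have key := tint_conj_commutator (h1 τ) (h2 τ) m pLτ pδX n
  rw [dt_smul _ jX, hδX, opmul_smul, tint_smul, hpow, tint_mul_comm, hpow, hδL, opmul_sub, tint_sub]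
  have e1 : mul ε (mul ε (S τ) (mul ε (mono n 1) (Si τ)))
        (mul ε (mul ε (S τ) m) (mul ε (mono 1 1) (Si τ)))
      = mul ε (mul ε (S τ) (mono n 1)) (mul ε m (mul ε (mono 1 1) (Si τ))) := by
    simp only [opmul_assoc]; rw [cancel_left (h2 τ)]
  have e2 : mul ε (mul ε (S τ) (mul ε (mono n 1) (Si τ)))
        (mul ε (S τ) (mul ε (mono 1 1) (mul ε m (Si τ))))
      = mul ε (mul ε (S τ) (mono (n + 1 : ℕ) 1)) (mul ε m (Si τ)) := by
    simp only [opmul_assoc]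
    rw [cancel_left (h2 τ), mono_mul_mono_mul, one_mul, Nat.cast_succ]
  rw [e1, e2, neg_mul, ← key]; ring

/-! ### Transport to the barred side by reflection -/

theorem flip_injective : Function.Injective (flip : DiffOp N → DiffOp N) := fun A B h => by
  rw [← flip_flip A, h, flip_flip]

theorem cancel_left_up {ε : ℝ} {S Si : DiffOp N} [Up S] [Up Si] (h : mul ε S Si = one)
    (X : DiffOp N) [Up X] : mul ε S (mul ε Si X) = X := by
  rw [← opmul_assoc, h, one_opmul]

theorem flip_conj (ε : ℝ) (S Si : DiffOp N) (d : ℤ) (M : Matrix (Fin N) (Fin N) ℂ) :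
    flip (mul ε S (mul ε (mono d M) Si))
      = mul (-ε) (flip S) (mul (-ε) (mono (-d) M) (flip Si)) := by
  rw [flip_mul, flip_mul, flip_mono]

theorem flip_mul_eq_one {ε : ℝ} {S Si : DiffOp N} (h : mul ε S Si = one) :
    mul (-ε) (flip S) (flip Si) = one := by
  rw [← flip_mul, h, flip_one]

theorem flip_sub (A B : DiffOp N) : flip (A - B) = flip A - flip B := rfl

theorem pow_conj_up {ε : ℝ} {S Si : DiffOp N} [Up S] [Up Si] (h1 : mul ε S Si = one)
    (h2 : mul ε Si S = one) (M : Matrix (Fin N) (Fin N) ℂ) (d : ℤ) (n : ℕ) :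
    pow ε (mul ε S (mul ε (mono d M) Si)) n = mul ε S (mul ε (mono (n * d) (M ^ n)) Si) := by
  apply flip_injective
  rw [flip_pow, flip_conj, flip_conj, pow_conj (flip_mul_eq_one h1) (flip_mul_eq_one h2), mul_neg]

theorem dx_conj_up {ε : ℝ} {S Si : DiffOp N} [Up S] [Up Si] [Smo S] [Smo Si]
    (h1 : mul ε S Si = one) (h2 : mul ε Si S = one) (d : ℤ) :
    dx (mul ε S (mul ε (mono d 1) Si))
      = mul ε (mul ε (dx S) Si) (mul ε S (mul ε (mono d 1) Si))
        - mul ε (mul ε S (mul ε (mono d 1) Si)) (mul ε (dx S) Si) := by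
  apply flip_injective
  rw [flip_dx, flip_sub, flip_mul ε (mul ε (dx S) Si), flip_mul ε _ (mul ε (dx S) Si), flip_conj,
    flip_mul ε (dx S), flip_dx]
  exact dx_conj (flip_mul_eq_one h1) (flip_mul_eq_one h2) (-d)

/-! ### Points of the phase space -/

section
variable {ε T : ℝ} (p : Phase N ε T)

theorem S_degLE : DegLE 0 p.1.S := p.2.S_pos
theorem Sinv_degLE : DegLE 0 p.1.Sinv := p.2.Sinv_pos
theorem Sb_degGE : DegGE 0 p.1.Sb := p.2.Sb_neg
theorem Sbinv_degGE : DegGE 0 p.1.Sbinv := p.2.Sbinv_neg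

instance lo_S : Lo p.1.S := ⟨0, S_degLE p⟩
instance lo_Sinv : Lo p.1.Sinv := ⟨0, Sinv_degLE p⟩
instance up_Sb : Up p.1.Sb := ⟨0, Sb_degGE p⟩
instance up_Sbinv : Up p.1.Sbinv := ⟨0, Sbinv_degGE p⟩
instance smo_S : Smo p.1.S := ⟨p.2.S_smooth⟩
instance smo_Sb : Smo p.1.Sb := ⟨p.2.Sb_smooth⟩

/-- The phase space postulates smoothness only of `S` and `S̄`; for the inverses it follows by
applying `JSm.inv` to a constant family, after reflection in the barred case. -/
instance smo_Sinv : Smo p.1.Sinv :=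
  ((JSm.const p.1.S).inv ε (Si := fun _ => p.1.Sinv) (fun _ => S_degLE p)
    (fun _ => Sinv_degLE p) (fun _ => p.2.S_mul_inv)).smo 0

instance smo_Sbinv : Smo p.1.Sbinv := by
  have h := ((JSm.const p.1.Sb).flip.inv (-ε) (Si := fun _ => flip p.1.Sbinv)
    (fun _ => (Sb_degGE p).flip) (fun _ => (Sbinv_degGE p).flip)
    (fun _ => flip_mul_eq_one p.2.Sb_mul_inv)).smo 0
  rw [← flip_flip p.1.Sbinv]
  exact smo_flip _

theorem lax_degLE : DegLE 1 (lax ε p.1) :=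
  ((S_degLE p).mul ε ((mono_degLE 1 1).mul ε (Sinv_degLE p))).mono (by norm_num)

/-- The dressing by `S` bounds the degree from above, the one by `S̄` from below; their equality
confines `L` to degrees -1, 0, 1. -/
theorem lax_degGE : DegGE (-1) (lax ε p.1) := by
  rw [p.2.lax_eq]
  exact ((Sb_degGE p).mul ε ((mono_degGE (-1) 1).mul ε (Sbinv_degGE p))).mono (by norm_num)

instance lo_lax : Lo (lax ε p.1) := ⟨_, lax_degLE p⟩
instance up_lax : Up (lax ε p.1) := ⟨_, lax_degGE p⟩
instance smo_lax : Smo (lax ε p.1) := by unfold lax; infer_instance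
instance per_lax : Per T (lax ε p.1) := ⟨p.2.lax_periodic⟩
instance lo_C (k : Fin N) : Lo (C ε p.1 k) := by unfold C; infer_instance
instance smo_C (k : Fin N) : Smo (C ε p.1 k) := by unfold C; infer_instance
instance per_C (k : Fin N) : Per T (C ε p.1 k) := ⟨p.2.C_periodic k⟩
instance up_Cbar (k : Fin N) : Up (Cbar ε p.1 k) := by unfold Cbar; infer_instance
instance smo_Cbar (k : Fin N) : Smo (Cbar ε p.1 k) := by unfold Cbar; infer_instance
instance per_Cbar (k : Fin N) : Per T (Cbar ε p.1 k) := ⟨p.2.Cbar_periodic k⟩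
instance smo_logL : Smo (logL ε p.1) := by unfold logL; infer_instance
instance per_logL : Per T (logL ε p.1) := ⟨p.2.log_periodic⟩
instance smo_powLog (j : ℕ) : Smo (powLog ε p.1 j) := by unfold powLog; infer_instance
instance per_powLog (j : ℕ) : Per T (powLog ε p.1 j) := by unfold powLog; infer_instance

/-! ### Algebraic relations between the Lax operator, the idempotents and the logarithm -/

theorem E_mul_E (k : Fin N) : E k * E k = E k := by simp [E]

theorem S_zero_apply (x : ℝ) : p.1.S 0 x = 1 := congrFun p.2.S_zero x

theorem Sinv_zero_apply (x : ℝ) : p.1.Sinv 0 x = 1 := by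
  have h := congrFun (congrFun p.2.S_mul_inv 0) x
  rw [mul_eq_sum ε _ _ 0 {0}] at h
  · simpa [S_zero_apply, one, mono] using h
  · intro m h1 h2
    have := (S_degLE p).le h1
    have := (Sinv_degLE p).le h2
    rw [Finset.mem_singleton]; omega

theorem lax_one_apply (x : ℝ) : lax ε p.1 1 x = 1 := by
  rw [lax, mul_eq_sum ε _ _ 1 {0}]
  · simp [S_zero_apply, mono_mul, Sinv_zero_apply]
  · intro m h1 h2
    have := (S_degLE p).le h1
    have := ((mono_degLE 1 1).mul ε (Sinv_degLE p)).le h2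
    rw [Finset.mem_singleton]; omega

theorem mul_lax (A : DiffOp N) (n : ℤ) (x : ℝ) :
    mul ε A (lax ε p.1) n x = A (n - 1) x + A n x * u ε p.1 (x + n * ε)
      + A (n + 1) x * v ε p.1 (x + (n + 1) * ε) := by
  rw [mul_eq_sum ε _ _ n {n - 1, n, n + 1}, Finset.sum_insert (by simp; omega),
    Finset.sum_insert (by simp),
    Finset.sum_singleton]
  · simp [lax_one_apply, u, v, add_assoc]
  · intro m _ h2
    have := (lax_degLE p).le h2
    have := (lax_degGE p).le h2
    simp only [Finset.mem_insert, Finset.mem_singleton]; omega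

theorem lax_mul (A : DiffOp N) (n : ℤ) (x : ℝ) :
    mul ε (lax ε p.1) A n x = A (n - 1) (x + ε) + u ε p.1 x * A n x
      + v ε p.1 x * A (n + 1) (x - ε) := by
  rw [mul_eq_sum ε _ _ n {1, 0, -1}, Finset.sum_insert (by simp), Finset.sum_insert (by simp),
    Finset.sum_singleton]
  · simp [lax_one_apply, u, v, add_assoc, sub_eq_add_neg]
  · intro m h2 _
    have := (lax_degLE p).le h2
    have := (lax_degGE p).le h2
    simp only [Finset.mem_insert, Finset.mem_singleton]; omega

theorem lax_pow (j : ℕ) :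
    pow ε (lax ε p.1) j = mul ε p.1.S (mul ε (mono j 1) p.1.Sinv) := by
  rw [lax, pow_conj p.2.S_mul_inv p.2.inv_mul_S, one_pow, mul_one]

theorem lax_pow_bar (j : ℕ) :
    pow ε (lax ε p.1) j = mul ε p.1.Sb (mul ε (mono (-(j : ℤ)) 1) p.1.Sbinv) := by
  rw [p.2.lax_eq, laxBar, pow_conj_up p.2.Sb_mul_inv p.2.inv_mul_Sb, one_pow, mul_neg_one]

theorem C_mul_C (k : Fin N) : mul ε (C ε p.1 k) (C ε p.1 k) = C ε p.1 k := by
  simp only [C, opmul_assoc]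
  rw [cancel_left p.2.inv_mul_S, mono_mul_mono_mul, E_mul_E, add_zero]

theorem Cbar_mul_Cbar (k : Fin N) : mul ε (Cbar ε p.1 k) (Cbar ε p.1 k) = Cbar ε p.1 k := by
  simp only [Cbar, opmul_assoc]
  rw [cancel_left_up p.2.inv_mul_Sb, mono_mul_mono_mul, E_mul_E, add_zero]

theorem C_commute (k : Fin N) :
    mul ε (C ε p.1 k) (lax ε p.1) = mul ε (lax ε p.1) (C ε p.1 k) := by
  simp only [C, lax, opmul_assoc]
  rw [cancel_left p.2.inv_mul_S, cancel_left p.2.inv_mul_S, mono_mul_mono_mul, mono_mul_mono_mul,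
    one_mul, mul_one, add_comm]

theorem Cbar_commute (k : Fin N) :
    mul ε (Cbar ε p.1 k) (lax ε p.1) = mul ε (lax ε p.1) (Cbar ε p.1 k) := by
  rw [p.2.lax_eq]
  simp only [Cbar, laxBar, opmul_assoc]
  rw [cancel_left_up p.2.inv_mul_Sb, cancel_left_up p.2.inv_mul_Sb, mono_mul_mono_mul,
    mono_mul_mono_mul, one_mul, mul_one, add_comm]

theorem B_eq (j : ℕ) (k : Fin N) : B ε p.1 j k = mul ε (C ε p.1 k) (pow ε (lax ε p.1) j) := by
  rw [lax_pow]
  simp only [B, C, opmul_assoc]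
  rw [cancel_left p.2.inv_mul_S, mono_mul_mono_mul, zero_add, mul_one]

theorem Bbar_eq (j : ℕ) (k : Fin N) :
    Bbar ε p.1 j k = mul ε (Cbar ε p.1 k) (pow ε (lax ε p.1) j) := by
  rw [lax_pow_bar]
  simp only [Bbar, Cbar, opmul_assoc]
  rw [cancel_left_up p.2.inv_mul_Sb, mono_mul_mono_mul, zero_add, mul_one]

/-- The `E_kk` sum to the identity. This is how the sum over `k` enters the recursion for the
logarithmic flows. -/
theorem sum_B (j : ℕ) : ∑ k, B ε p.1 j k = pow ε (lax ε p.1) j := by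
  have hE : ∑ k : Fin N, E k = 1 := by
    ext a b
    simp only [Matrix.sum_apply, E, Matrix.single_apply, Matrix.one_apply]
    by_cases h : a = b
    · subst h; simp
    · rw [if_neg h]; refine Finset.sum_eq_zero fun k _ => if_neg ?_
      rintro ⟨rfl, rfl⟩; exact h rfl
  have hsum : ∀ s : Finset (Fin N), ∑ k ∈ s, B ε p.1 j k
      = mul ε p.1.S (mul ε (mono j (∑ k ∈ s, E k)) p.1.Sinv) := fun s => by
    induction s using Finset.induction_on with
    | empty =>
      have h0 : mono (N := N) j 0 = 0 := by funext n x; simp [mono]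
      simp [h0, zero_opmul, opmul_zero]
    | insert k s hk ih =>
      have hm : mono (N := N) j (E k + ∑ k ∈ s, E k) = mono j (E k) + mono j (∑ k ∈ s, E k) := by
        funext n x; simp only [mono, Pi.add_apply]; split_ifs <;> simp
      rw [Finset.sum_insert hk, Finset.sum_insert hk, ih, hm, add_opmul, opmul_add]; rfl
  rw [hsum, hE, lax_pow]

/-- Differentiating the two dressed forms gives `L_x = [S_x S⁻¹, L] = [S̄_x S̄⁻¹, L]`, so the
difference of the two logarithmic derivatives commutes with `L`. -/
theorem logL_commute : mul ε (logL ε p.1) (lax ε p.1) = mul ε (lax ε p.1) (logL ε p.1) := by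
  have h1 := dx_conj p.2.S_mul_inv p.2.inv_mul_S 1
  have h2 := dx_conj_up p.2.Sb_mul_inv p.2.inv_mul_Sb (-1)
  rw [show mul ε p.1.Sb (mul ε (mono (-1) 1) p.1.Sbinv) = lax ε p.1 from p.2.lax_eq.symm] at h2
  rw [show mul ε p.1.S (mul ε (mono 1 1) p.1.Sinv) = lax ε p.1 from rfl, h2] at h1
  rw [logL, smul_opmul, opmul_smul, sub_opmul, opmul_sub]
  simp only [smul_opmul, opmul_smul, ← smul_sub]
  congr 2
  rw [sub_eq_sub_iff_add_eq_add] at h1 ⊢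
  rw [h1, add_comm]

theorem logL_sub_commute (c : ℂ) :
    mul ε (logL ε p.1 - c • one) (lax ε p.1) = mul ε (lax ε p.1) (logL ε p.1 - c • one) := by
  rw [sub_opmul, opmul_sub, logL_commute, smul_opmul, opmul_smul, one_opmul, opmul_one]

theorem powLog_commute (j : ℕ) :
    mul ε (powLog ε p.1 j) (lax ε p.1) = mul ε (lax ε p.1) (powLog ε p.1 j) := by
  rw [powLog, opmul_assoc, logL_sub_commute, ← opmul_assoc, ← opmul_assoc, ← pow_succ_right]; rfl

instance smo_gen (f : Flow N) : Smo (gen ε p.1 f) := by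
  cases f with
  | t j k => show Smo (B ε p.1 j k); rw [B_eq]; infer_instance
  | tbar j k => show Smo (Bbar ε p.1 j k); rw [Bbar_eq]; infer_instance
  | s j => show Smo ((2 / (j.factorial : ℂ)) • powLog ε p.1 j); infer_instance

instance per_gen (f : Flow N) : Per T (gen ε p.1 f) := by
  cases f with
  | t j k => show Per T (B ε p.1 j k); rw [B_eq]; infer_instance
  | tbar j k => show Per T (Bbar ε p.1 j k); rw [Bbar_eq]; infer_instance
  | s j => show Per T ((2 / (j.factorial : ℂ)) • powLog ε p.1 j); infer_instance

/-- The only property of the generators, apart from their recursion, that the bracket computations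
use. -/
theorem gen_commute (f : Flow N) :
    mul ε (gen ε p.1 f) (lax ε p.1) = mul ε (lax ε p.1) (gen ε p.1 f) := by
  cases f with
  | t j k =>
    show mul ε (B ε p.1 j k) _ = mul ε _ (B ε p.1 j k)
    rw [B_eq, opmul_assoc, ← pow_succ_right, pow_commute ε _ _ (C_commute p k),
      pow_commute ε _ _ (C_commute p k), pow, opmul_assoc]
  | tbar j k =>
    show mul ε (Bbar ε p.1 j k) _ = mul ε _ (Bbar ε p.1 j k)
    rw [Bbar_eq, opmul_assoc, ← pow_succ_right, pow_commute ε _ _ (Cbar_commute p k),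
      pow_commute ε _ _ (Cbar_commute p k), pow, opmul_assoc]
  | s j =>
    show mul ε ((2 / (j.factorial : ℂ)) • powLog ε p.1 j) _
      = mul ε _ ((2 / (j.factorial : ℂ)) • powLog ε p.1 j)
    rw [smul_opmul, opmul_smul, powLog_commute]

theorem B_succ (j : ℕ) (k : Fin N) : mul ε (B ε p.1 j k) (lax ε p.1) = B ε p.1 (j + 1) k := by
  rw [B_eq, B_eq, opmul_assoc, ← pow_succ_right]

theorem Bbar_succ (j : ℕ) (k : Fin N) :
    mul ε (Bbar ε p.1 j k) (lax ε p.1) = Bbar ε p.1 (j + 1) k := by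
  rw [Bbar_eq, Bbar_eq, opmul_assoc, ← pow_succ_right]

/-- Replacing `c_j` by `c_{j+1} - 1/(j+1)` leaves the multiple `2/(j+1)!` of `L^(j+1)`, which is the
sum of the `B_{j+1,k}`. -/
theorem D_succ (j : ℕ) : mul ε (D ε p.1 j) (lax ε p.1)
    = ((j + 1 : ℕ) : ℂ) • D ε p.1 (j + 1)
      + (2 / ((j + 1).factorial : ℂ)) • ∑ k, B ε p.1 (j + 1) k := by
  have h1 : (j.factorial : ℂ) ≠ 0 := by exact_mod_cast j.factorial_ne_zero
  have h2 : (j : ℂ) + 1 ≠ 0 := by exact_mod_cast j.succ_ne_zero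
  rw [sum_B, D, D, smul_opmul, powLog, powLog, opmul_assoc, logL_sub_commute, ← opmul_assoc,
    ← pow_succ_right, opmul_sub, opmul_sub, opmul_smul, opmul_smul, opmul_one, harmonic_succ]
  simp only [smul_sub, smul_smul]
  rw [sub_add_eq_add_sub, add_sub_assoc, sub_eq_add_neg]
  have e1 : 2 / (j.factorial : ℂ) = ((j + 1 : ℕ) : ℂ) * (2 / ((j + 1).factorial : ℂ)) := by
    rw [Nat.factorial_succ]; push_cast; field_simp
  congr 1
  · rw [e1]
  · rw [← sub_smul, ← neg_smul, e1]
    congr 1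
    push_cast
    field_simp
    ring
end

section
variable {ε T : ℝ}

/-! ### Periodicity of the two halves of the logarithm -/

/-- Only the combination `log L` is assumed periodic. As `S_0 = 1` is constant, `S_x S⁻¹` lives in
negative degrees and `S̄_x S̄⁻¹` in non-negative ones, so each half can be read off from `log L`
separately. -/
theorem per_log_parts (hε : ε ≠ 0) (p : Phase N ε T) :
    Per T (mul ε (dx p.1.S) p.1.Sinv) ∧ Per T (mul ε (dx p.1.Sb) p.1.Sbinv) := by
  have hc : (ε : ℂ) ≠ 0 := by exact_mod_cast hε
  have hdS : DegLE (-1) (dx p.1.S) := fun n hn => by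
    rcases (show n = 0 ∨ 0 < n by omega) with rfl | h
    · funext x; ext i j; simp [dx, p.2.S_zero]
    · exact dx_eq_zero (p.2.S_pos n h)
  have hX : ∀ n, 0 ≤ n → mul ε (dx p.1.S) p.1.Sinv n = 0 := fun n hn =>
    hdS.mul ε (Sinv_degLE p) n (by omega)
  have hXb : ∀ n, n < 0 → mul ε (dx p.1.Sb) p.1.Sbinv n = 0 := fun n hn =>
    (Sb_degGE p).dx.mul ε (Sbinv_degGE p) n (by omega)
  have hlog : ∀ n x, logL ε p.1 n x = (1 / 2 : ℂ) • ((ε : ℂ) • mul ε (dx p.1.Sb) p.1.Sbinv n x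
      - (ε : ℂ) • mul ε (dx p.1.S) p.1.Sinv n x) := fun _ _ => rfl
  refine ⟨⟨fun n x => ?_⟩, ⟨fun n x => ?_⟩⟩
  · rcases lt_or_ge n 0 with h | h
    · have hp := p.2.log_periodic n x
      simp only [hlog, hXb n h, Pi.zero_apply, smul_zero, zero_sub, smul_neg, neg_inj] at hp
      exact smul_right_injective _ hc (smul_right_injective _ (by norm_num : (1 / 2 : ℂ) ≠ 0) hp)
    · rw [hX n h]; rfl
  · rcases lt_or_ge n 0 with h | h
    · rw [hXb n h]; rfl
    · have hp := p.2.log_periodic n x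
      simp only [hlog, hX n h, Pi.zero_apply, smul_zero, sub_zero] at hp
      exact smul_right_injective _ hc (smul_right_injective _ (by norm_num : (1 / 2 : ℂ) ≠ 0) hp)

/-! ### Variations -/

section
variable {p : Phase N ε T} {γ : ℝ → Phase N ε T}

theorem fLo_S : FLo fun t => (γ t).1.S := ⟨0, fun t => S_degLE (γ t)⟩
theorem fLo_Sinv : FLo fun t => (γ t).1.Sinv := ⟨0, fun t => Sinv_degLE (γ t)⟩
theorem fUp_Sb : FUp fun t => (γ t).1.Sb := ⟨0, fun t => Sb_degGE (γ t)⟩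
theorem fUp_Sbinv : FUp fun t => (γ t).1.Sbinv := ⟨0, fun t => Sbinv_degGE (γ t)⟩
theorem fLo_lax : FLo fun t => lax ε (γ t).1 := ⟨1, fun t => lax_degLE (γ t)⟩
theorem fUp_lax : FUp fun t => lax ε (γ t).1 := ⟨-1, fun t => lax_degGE (γ t)⟩

theorem fLo_C (k : Fin N) : FLo fun t => C ε (γ t).1 k :=
  fLo_S.mul ε ((FLo.const (mono 0 (E k))).mul ε fLo_Sinv)

theorem fUp_Cbar (k : Fin N) : FUp fun t => Cbar ε (γ t).1 k :=
  fUp_Sb.mul ε ((FUp.const (mono 0 (E k))).mul ε fUp_Sbinv)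

variable (hγ : IsVariation p γ)
include hγ

theorem jSm_S : JSm fun t => (γ t).1.S := hγ.S_smooth
theorem jSm_Sb : JSm fun t => (γ t).1.Sb := hγ.Sb_smooth

theorem jSm_Sinv : JSm fun t => (γ t).1.Sinv :=
  (jSm_S hγ).inv ε (fun t => S_degLE (γ t)) (fun t => Sinv_degLE (γ t))
    (fun t => (γ t).2.S_mul_inv)

theorem jSm_flip_Sbinv : JSm fun t => flip (γ t).1.Sbinv :=
  (jSm_Sb hγ).flip.inv (-ε) (fun t => (Sb_degGE (γ t)).flip) (fun t => (Sbinv_degGE (γ t)).flip)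
    (fun t => flip_mul_eq_one (γ t).2.Sb_mul_inv)

theorem jSm_Sbinv : JSm fun t => (γ t).1.Sbinv := by
  have h := (jSm_flip_Sbinv hγ).flip
  simpa only [flip_flip] using h

theorem jSm_conj (d : ℤ) (M : Matrix (Fin N) (Fin N) ℂ) :
    JSm fun t => mul ε (γ t).1.S (mul ε (mono d M) (γ t).1.Sinv) :=
  (jSm_S hγ).mul ε ((JSm.const (mono d M)).mul ε (jSm_Sinv hγ)
    (FOK.lo (FLo.const _) fLo_Sinv)) (FOK.lo fLo_S ((FLo.const _).mul ε fLo_Sinv))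

theorem jSm_conj_bar (d : ℤ) (M : Matrix (Fin N) (Fin N) ℂ) :
    JSm fun t => mul ε (γ t).1.Sb (mul ε (mono d M) (γ t).1.Sbinv) :=
  (jSm_Sb hγ).mul ε ((JSm.const (mono d M)).mul ε (jSm_Sbinv hγ)
    (FOK.up (FUp.const _) fUp_Sbinv)) (FOK.up fUp_Sb ((FUp.const _).mul ε fUp_Sbinv))

theorem jSm_lax : JSm fun t => lax ε (γ t).1 := jSm_conj hγ 1 1
theorem jSm_C (k : Fin N) : JSm fun t => C ε (γ t).1 k := jSm_conj hγ 0 (E k)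
theorem jSm_Cbar (k : Fin N) : JSm fun t => Cbar ε (γ t).1 k := jSm_conj_bar hγ 0 (E k)

theorem jSm_X : JSm fun t => mul ε (dx (γ t).1.S) (γ t).1.Sinv :=
  (jSm_S hγ).dx.mul ε (jSm_Sinv hγ) (FOK.lo fLo_S.dx fLo_Sinv)

theorem jSm_Xbar : JSm fun t => mul ε (dx (γ t).1.Sb) (γ t).1.Sbinv :=
  (jSm_Sb hγ).dx.mul ε (jSm_Sbinv hγ) (FOK.up fUp_Sb.dx fUp_Sbinv)

theorem jSm_logL : JSm fun t => logL ε (γ t).1 :=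
  JSm.smul _ (((jSm_Xbar hγ).smul _).sub ((jSm_X hγ).smul _))

/-- The variation of `∫ Tr Res C_kk L^(j+1)`. -/
theorem tint_dt_C_pow (j : ℕ) (k : Fin N) :
    tint T (dt (fun t => mul ε (C ε (γ t).1 k) (pow ε (lax ε (γ t).1) (j + 1))) 0)
      = (j + 1) * tint T (mul ε (B ε p.1 j k) (dt (fun t => lax ε (γ t).1) 0)) := by
  obtain rfl := hγ.base
  have jL := jSm_lax hγ
  have jC := jSm_C hγ k
  have := fLo_lax (γ := γ).dt.lo 0
  have := fUp_lax (γ := γ).dt.up 0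
  have := jL.dt.smo 0
  have : Per T (dt (fun t => lax ε (γ t).1) 0) := dt_per (fun t => per_lax (γ t)) 0
  have := (fLo_C (γ := γ) k).dt.lo 0
  have := jC.dt.smo 0
  have : Per T (dt (fun t => C ε (γ t).1 k) 0) := dt_per (fun t => per_C (γ t) k) 0
  have hδC := dt_mul ε jC jC (FOK.lo (fLo_C k) (fLo_C k)) 0
  simp only [C_mul_C] at hδC
  rw [dt_mul ε jC (jL.pow ε fLo_lax fUp_lax _) (FOK.lo (fLo_C k) (fLo_lax.pow ε _)),
    dt_pow ε jL fLo_lax fUp_lax, tint_add,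
    tint_idempotent ε (lax ε (γ 0).1) _ _ (C_mul_C (γ 0) k) (C_commute (γ 0) k) hδC, zero_add,
    tint_mul_comm, tint_dpow ε _ _ j _ (C_commute (γ 0) k), B_eq,
    pow_commute ε _ _ (C_commute (γ 0) k)]

/-- The variation of `∫ Tr Res C̄_kk L^(j+1)`. -/
theorem tint_dt_Cbar_pow (j : ℕ) (k : Fin N) :
    tint T (dt (fun t => mul ε (Cbar ε (γ t).1 k) (pow ε (lax ε (γ t).1) (j + 1))) 0)
      = (j + 1) * tint T (mul ε (Bbar ε p.1 j k) (dt (fun t => lax ε (γ t).1) 0)) := by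
  obtain rfl := hγ.base
  have jL := jSm_lax hγ
  have jC := jSm_Cbar hγ k
  have := fLo_lax (γ := γ).dt.lo 0
  have := fUp_lax (γ := γ).dt.up 0
  have := jL.dt.smo 0
  have : Per T (dt (fun t => lax ε (γ t).1) 0) := dt_per (fun t => per_lax (γ t)) 0
  have := (fUp_Cbar (γ := γ) k).dt.up 0
  have := jC.dt.smo 0
  have : Per T (dt (fun t => Cbar ε (γ t).1 k) 0) := dt_per (fun t => per_Cbar (γ t) k) 0
  have hδC := dt_mul ε jC jC (FOK.up (fUp_Cbar k) (fUp_Cbar k)) 0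
  simp only [Cbar_mul_Cbar] at hδC
  have hz : tint T (mul ε (dt (fun t => Cbar ε (γ t).1 k) 0)
      (pow ε (lax ε (γ 0).1) (j + 1))) = 0 := by
    -- `tint_idempotent` is stated for operators bounded above; reflection brings `C̄_kk` into that
    -- form and does not change the residue.
    rw [← tint_flip, flip_mul, flip_pow]
    refine tint_idempotent (-ε) _ (flip (Cbar ε (γ 0).1 k)) _ ?_ ?_ ?_ _
    · rw [← flip_mul, Cbar_mul_Cbar]
    · rw [← flip_mul, Cbar_commute, flip_mul]
    · rw [← flip_mul, ← flip_mul]; exact congrArg flip hδC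
  rw [dt_mul ε jC (jL.pow ε fLo_lax fUp_lax _) (FOK.up (fUp_Cbar k) (fUp_lax.pow ε _)),
    dt_pow ε jL fLo_lax fUp_lax, tint_add, hz, zero_add,
    tint_mul_comm, tint_dpow ε _ _ j _ (Cbar_commute (γ 0) k), Bbar_eq,
    pow_commute ε _ _ (Cbar_commute (γ 0) k)]

/-- `∫ Tr Res L^(n+1) δ(log L) = ∫ Tr Res L^n δL`. -/
theorem tint_pow_dt_logL (hε : ε ≠ 0) (n : ℕ) :
    tint T (mul ε (pow ε (lax ε p.1) (n + 1)) (dt (fun t => logL ε (γ t).1) 0))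
      = tint T (mul ε (pow ε (lax ε p.1) n) (dt (fun t => lax ε (γ t).1) 0)) := by
  obtain rfl := hγ.base
  have h1 := tint_pow_dt_log (T := T) (jSm_S hγ) (jSm_Sinv hγ) fLo_S fLo_Sinv
    (fun t => (γ t).2.S_mul_inv) (fun t => (γ t).2.inv_mul_S) (L := fun t => lax ε (γ t).1)
    (fun _ => rfl) (fun t => per_lax (γ t)) (fun t => (per_log_parts hε (γ t)).1) 0 n
  have hfX : ∀ t, mul (-ε) (dx (flip (γ t).1.Sb)) (flip (γ t).1.Sbinv)
      = flip (mul ε (dx (γ t).1.Sb) (γ t).1.Sbinv) := fun t => by rw [flip_mul, flip_dx]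
  -- After reflection `L` becomes the dressing of `Λ` by the reflected `S̄` with step `-ε`, and the
  -- factor `-(-ε) = ε` produces the correct sign of the second half of the logarithm.
  have h2 := tint_pow_dt_log (T := T) (ε := -ε) (jSm_Sb hγ).flip (jSm_flip_Sbinv hγ) fUp_Sb.flip
    fUp_Sbinv.flip (fun t => flip_mul_eq_one (γ t).2.Sb_mul_inv)
    (fun t => flip_mul_eq_one (γ t).2.inv_mul_Sb) (L := fun t => flip (lax ε (γ t).1))
    (fun t => by rw [(γ t).2.lax_eq, laxBar, flip_conj, neg_neg]) (fun t => inferInstance)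
    (fun t => by
      have := (per_log_parts hε (γ t)).2
      rw [hfX]; infer_instance) 0 n
  have hneg : -((-ε : ℝ) : ℂ) = ε := by push_cast; ring
  simp only [hfX, hneg] at h2
  rw [show (fun t => (ε : ℂ) • flip (mul ε (dx (γ t).1.Sb) (γ t).1.Sbinv))
      = fun t => flip ((ε : ℂ) • mul ε (dx (γ t).1.Sb) (γ t).1.Sbinv) from rfl, dt_flip, dt_flip,
    ← flip_pow, ← flip_pow, ← flip_mul, ← flip_mul, tint_flip, tint_flip] at h2
  have jX := (jSm_X hγ).smul (-(ε : ℂ))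
  have jXb := (jSm_Xbar hγ).smul (ε : ℂ)
  have := jX.dt.smo 0
  have := jXb.dt.smo 0
  -- Each half of the logarithm contributes the full trace `∫ Tr Res L^n δL`, and `log L` is their
  -- average.
  have hlog : (fun t => logL ε (γ t).1) = fun t => (1 / 2 : ℂ) •
      ((ε : ℂ) • mul ε (dx (γ t).1.Sb) (γ t).1.Sbinv
        + -(ε : ℂ) • mul ε (dx (γ t).1.S) (γ t).1.Sinv) := by
    funext t; rw [logL, neg_smul, sub_eq_add_neg]
  rw [hlog, dt_smul _ (jXb.add jX), dt_add jXb jX, opmul_smul, tint_smul, opmul_add, tint_add, h1,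
    h2]
  ring

/-- The variation of `∫ Tr Res L^(j+1) (log L - c_(j+1))`. -/
theorem tint_dt_powLog (hε : ε ≠ 0) (j : ℕ) :
    tint T (dt (fun t => powLog ε (γ t).1 (j + 1)) 0)
      = (j + 1) * tint T (mul ε (powLog ε p.1 j) (dt (fun t => lax ε (γ t).1) 0)) := by
  have hlog := tint_pow_dt_logL hγ hε j
  obtain rfl := hγ.base
  have jL := jSm_lax hγ
  have := fLo_lax (γ := γ).dt.lo 0
  have := fUp_lax (γ := γ).dt.up 0
  have := jL.dt.smo 0
  have : Per T (dt (fun t => lax ε (γ t).1) 0) := dt_per (fun t => per_lax (γ t)) 0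
  have := (jSm_logL hγ).dt.smo 0
  set c : ℕ → ℂ := fun j => ((harmonic j : ℚ) : ℂ) with hc
  have hcs : c (j + 1) = c j + 1 / (j + 1) := by
    simp only [hc]; rw [harmonic_succ]; push_cast; rw [one_div]
  have jc := JSm.const (c (j + 1) • (one : DiffOp N))
  have jZ := (jSm_logL hγ).sub jc
  have fokZ : FOK (fun t => pow ε (lax ε (γ t).1) (j + 1))
      (fun t => logL ε (γ t).1 - c (j + 1) • one) :=
    FOK.fin (fLo_lax.pow ε _) (fUp_lax.pow ε _)
  have e1 : dt (fun t => powLog ε (γ t).1 (j + 1)) 0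
      = mul ε (dpow ε (lax ε (γ 0).1) (dt (fun t => lax ε (γ t).1) 0) (j + 1))
          (logL ε (γ 0).1 - c (j + 1) • one)
        + mul ε (pow ε (lax ε (γ 0).1) (j + 1)) (dt (fun t => logL ε (γ t).1) 0) := by
    have h := dt_mul ε (jL.pow ε fLo_lax fUp_lax (j + 1)) jZ fokZ 0
    rw [dt_pow ε jL fLo_lax fUp_lax, dt_sub (jSm_logL hγ) jc, dt_const, sub_zero] at h
    exact h
  -- This is where the harmonic constants matter: the extra `L^j` coming from `δ(log L)` is absorbed
  -- by `(j+1)(c_{j+1} - c_j) = 1`.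
  have e2 : powLog ε (γ 0).1 j
      = mul ε (pow ε (lax ε (γ 0).1) j) (logL ε (γ 0).1 - c (j + 1) • one)
        + (1 / (j + 1) : ℂ) • pow ε (lax ε (γ 0).1) j := by
    rw [powLog, opmul_sub, opmul_sub, hcs, opmul_smul, opmul_smul, opmul_one, add_smul]
    abel
  have hj : (j : ℂ) + 1 ≠ 0 := by exact_mod_cast j.succ_ne_zero
  rw [e1, tint_add, tint_dpow ε _ _ j _ (logL_sub_commute (γ 0) _), hlog, e2, add_opmul, tint_add,
    smul_opmul, tint_smul]
  field_simp
end

/-! ### Variational derivatives -/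

/-- Only the coefficients of `A` in degrees 0 and 1 meet `δ`. Translating the density `Tr A_1(x)
δ_{-1}(x+ε)` by `-ε` frees `δ_{-1}` from the shift and moves it onto `A_1`. -/
theorem tint_mul_band (A δ : DiffOp N) [hA : Smo A] [hδ : Smo δ] [pA : Per T A] [pδ : Per T δ]
    (h1 : DegLE 0 δ) (h2 : DegGE (-1) δ) :
    tint T (mul ε A δ) = ∫ x in (0 : ℝ)..T, ∑ i, ∑ j,
      (A 0 x j i * δ 0 x i j + A 1 (x - ε) j i * δ (-1) x i j) := by
  let f : ℝ → ℂ := fun x => ∑ i, ∑ j, A 0 x j i * δ 0 x i j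
  let g : ℝ → ℂ := fun x => ∑ i, ∑ j, A 1 (x - ε) j i * δ (-1) x i j
  have hf : Continuous f := continuous_finsetSum _ fun i _ => continuous_finsetSum _ fun j _ =>
    (hA.out 0 j i).continuous.mul (hδ.out 0 i j).continuous
  have hg : Continuous g := continuous_finsetSum _ fun i _ => continuous_finsetSum _ fun j _ =>
    ((hA.out 1 j i).continuous.comp (by fun_prop : Continuous fun x : ℝ => x - ε)).mul
      (hδ.out (-1) i j).continuous
  have hgp : Function.Periodic g T := fun x => by
    simp only [g]; rw [pδ.out, show x + T - ε = x - ε + T by ring, pA.out]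
  have htr : ∀ x, trRes (mul ε A δ) x = f x + g (x + ε) := fun x => by
    simp only [trRes]
    rw [mul_eq_sum ε A δ 0 {0, 1}, Finset.sum_pair (by simp), Matrix.trace_add]
    · simp only [f, g, Matrix.trace, Matrix.diag_apply, Matrix.mul_apply]
      congr 1
      · rw [Finset.sum_comm]; simp
      · rw [Finset.sum_comm]; simp
    · intro m _ hm
      have := h1.le hm
      have := h2.le hm
      simp only [Finset.mem_insert, Finset.mem_singleton]; omega
  unfold tint
  simp only [htr, Finset.sum_add_distrib]
  rw [intervalIntegral.integral_add (g := fun x => g (x + ε)) (hf.intervalIntegrable _ _)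
    ((hg.comp (by fun_prop : Continuous fun x : ℝ => x + ε)).intervalIntegrable _ _),
    integral_periodic_comp_add g hgp]
  exact (intervalIntegral.integral_add (hf.intervalIntegrable _ _)
    (hg.intervalIntegrable _ _)).symm

/-- The generator of the flow is the gradient of its Hamiltonian under the trace pairing; the
factors `1/(j+1)` and `2/(j+1)!` are chosen to cancel the `j + 1` produced by differentiating a
power. -/
theorem hasDerivAt_Ham (hε : ε ≠ 0) (f : Flow N) {p : Phase N ε T} {γ : ℝ → Phase N ε T}
    (hγ : IsVariation p γ) :
    HasDerivAt (fun τ => Ham f (γ τ))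
      (tint T (mul ε (gen ε p.1 f) (dt (fun t => lax ε (γ t).1) 0))) 0 := by
  have jL := jSm_lax hγ
  have jLp := fun n => jL.pow ε fLo_lax fUp_lax n
  have hfac : ∀ j : ℕ, (j : ℂ) + 1 ≠ 0 := fun j => by exact_mod_cast j.succ_ne_zero
  cases f with
  | t j k =>
    have h := (hasDerivAt_tint T ((jSm_C hγ k).mul ε (jLp (j + 1))
      (FOK.lo (fLo_C k) (fLo_lax.pow ε _))) 0).const_mul (1 / ((j : ℂ) + 1))
    rw [tint_dt_C_pow hγ j k, ← mul_assoc, one_div_mul_cancel (hfac j), one_mul] at h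
    exact h
  | tbar j k =>
    have h := (hasDerivAt_tint T ((jSm_Cbar hγ k).mul ε (jLp (j + 1))
      (FOK.up (fUp_Cbar k) (fUp_lax.pow ε _))) 0).const_mul (1 / ((j : ℂ) + 1))
    rw [tint_dt_Cbar_pow hγ j k, ← mul_assoc, one_div_mul_cancel (hfac j), one_mul] at h
    exact h
  | s j =>
    have h := (hasDerivAt_tint T ((jLp (j + 1)).mul ε ((jSm_logL hγ).sub
      (JSm.const (((harmonic (j + 1) : ℚ) : ℂ) • (one : DiffOp N))))
      (FOK.fin (fLo_lax.pow ε _) (fUp_lax.pow ε _))) 0).const_mul (2 / ((j + 1).factorial : ℂ))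
    have e := tint_dt_powLog hγ hε j
    have h1 : (j.factorial : ℂ) ≠ 0 := by exact_mod_cast j.factorial_ne_zero
    have hF : (fun τ => Ham (Flow.s j) (γ τ)) = fun τ => 2 / ((j + 1).factorial : ℂ)
        * tint T (powLog ε (γ τ).1 (j + 1)) := by
      funext τ; exact intervalIntegral.integral_const_mul _ _
    have hG : mul ε (gen ε p.1 (Flow.s j)) (dt (fun t => lax ε (γ t).1) 0)
        = (2 / (j.factorial : ℂ)) • mul ε (powLog ε p.1 j) (dt (fun t => lax ε (γ t).1) 0) :=
      smul_opmul ε _ _ _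
    have hval : 2 / (j.factorial : ℂ) * tint T (mul ε (powLog ε p.1 j)
          (dt (fun t => lax ε (γ t).1) 0))
        = 2 / ((j + 1).factorial : ℂ) * tint T (dt (fun t => powLog ε (γ t).1 (j + 1)) 0) := by
      rw [e, Nat.factorial_succ]
      have := hfac j
      push_cast
      field_simp
    rw [hF, hG, tint_smul, hval]
    exact h

theorem isVarDeriv_Ham (hε : ε ≠ 0) (f : Flow N) (p : Phase N ε T) :
    IsVarDeriv (Ham f) p (fun i j x => gen ε p.1 f 0 x j i)
      (fun i j x => gen ε p.1 f 1 (x - ε) j i) where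
  du_smooth i j := ⟨(smo_gen p f).out 0 j i, fun x =>
    congrFun (congrFun ((per_gen p f).out 0 x) j) i⟩
  dv_smooth i j := ⟨((smo_gen p f).out 1 j i).comp (contDiff_id.sub contDiff_const), fun x => by
    have h := (per_gen p f).out 1 (x - ε)
    rw [show x - ε + T = x + T - ε by ring] at h
    exact congrFun (congrFun h j) i⟩
  variation γ hγ := by
    have h := hasDerivAt_Ham hε f hγ
    have := (jSm_lax hγ).dt.smo 0
    have : Per T (dt (fun t => lax ε (γ t).1) 0) := dt_per (fun t => per_lax (γ t)) 0
    have h1 : DegLE 0 (dt (fun t => lax ε (γ t).1) 0) := fun n hn => by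
      -- The leading coefficient of `L` is identically 1, so its variation vanishes and `δL` has no
      -- term in `Λ`.
      rcases (show n = 1 ∨ 1 < n by omega) with rfl | h
      · funext x; ext i j; simp [dt, lax_one_apply]
      · exact dt_apply_eq_zero (fun t => lax_degLE (γ t) n h) 0
    have h2 : DegGE (-1) (dt (fun t => lax ε (γ t).1) 0) := fun n hn =>
      dt_apply_eq_zero (fun t => lax_degGE (γ t) n hn) 0
    rw [tint_mul_band _ _ h1 h2] at h
    exact h

/-! ### Brackets in terms of the generator of a flow -/

section
variable (p : Phase N ε T)

theorem ite_sum_left (a : Fin N) (F : Fin N → Fin N → ℂ) :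
    ∑ i, ∑ j, (if a = j then F i j else 0) = ∑ i, F i a := by simp

theorem ite_sum_right (a : Fin N) (F : Fin N → Fin N → ℂ) :
    ∑ i, ∑ j, (if a = i then F i j else 0) = ∑ j, F a j := by
  rw [Finset.sum_comm]; simp

/-- The bracket consists of the terms with `u` and `v` in the degree 0 coefficient of `GL - LG`;
commutation exchanges them for the difference of `G_{-1}`. -/
theorem bracket1u_eq (G : DiffOp N) (hG : mul ε G (lax ε p.1) = mul ε (lax ε p.1) G)
    (a b : Fin N) (x : ℝ) :
    bracket1u ε p.1 (fun i j x => G 0 x j i) (fun i j x => G 1 (x - ε) j i) a b x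
      = (1 / (ε : ℂ)) * (G (-1) (x + ε) a b - G (-1) x a b) := by
  have h := congrFun (congrFun hG 0) x
  rw [mul_lax, lax_mul] at h
  have h' := congrFun (congrFun h a) b
  simp only [Matrix.add_apply, Matrix.mul_apply] at h'
  norm_num at h'
  unfold bracket1u
  congr 1
  simp only [Finset.sum_add_distrib, Finset.sum_sub_distrib, ite_sum_left, ite_sum_right,
    add_sub_cancel_right]
  simp only [mul_comm (u ε p.1 x _ b), mul_comm (v ε p.1 (x + ε) _ b)]
  linear_combination h'

theorem bracket1v_eq (G : DiffOp N) (a b : Fin N) (x : ℝ) :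
    bracket1v ε p.1 (fun i j x => G 0 x j i) a b x
      = (1 / (ε : ℂ)) * ((G 0 x * v ε p.1 x) a b - (v ε p.1 x * G 0 (x - ε)) a b) := by
  unfold bracket1v
  simp only [Finset.sum_sub_distrib, ite_sum_left, ite_sum_right, Matrix.mul_apply]
  simp only [mul_comm (v ε p.1 x _ b)]

/-- The same degree 0 identity as for `bracket1u_eq`. It exhibits the source as an exact difference,
so that `G_{-1}` can serve as the non-local term. -/
theorem nonlocalSource_eq (G : DiffOp N) (hG : mul ε G (lax ε p.1) = mul ε (lax ε p.1) G)
    (a b : Fin N) (x : ℝ) :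
    nonlocalSource ε p.1 (fun i j x => G 0 x j i) (fun i j x => G 1 (x - ε) j i) a b x
      = G (-1) (x + ε) a b - G (-1) x a b := by
  have h := congrFun (congrFun hG 0) x
  rw [mul_lax, lax_mul] at h
  have h' := congrFun (congrFun h a) b
  simp only [Matrix.add_apply, Matrix.mul_apply] at h'
  norm_num at h'
  unfold nonlocalSource
  simp only [Finset.sum_add_distrib, Finset.sum_sub_distrib, add_sub_cancel_right]
  simp only [mul_comm (u ε p.1 x _ b), mul_comm (v ε p.1 (x + ε) _ b)]
  linear_combination h'

theorem bracket2u_eq (G : DiffOp N) (hG : mul ε G (lax ε p.1) = mul ε (lax ε p.1) G)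
    (a b : Fin N) (x : ℝ) :
    bracket2u ε p.1 (fun i j x => G 0 x j i) (fun i j x => G (-1) x i j) a b x
      = (1 / (ε : ℂ)) * (mul ε G (lax ε p.1) (-1) (x + ε) a b
        - mul ε G (lax ε p.1) (-1) x a b) := by
  -- Expand the first value as `GL` and the second as `LG`: both then contain `G_{-2}(x+ε)`, which
  -- does not occur in the bracket and cancels.
  conv_rhs => rw [mul_lax, hG, lax_mul]
  rw [show (-1 : ℤ) - 1 = -2 by norm_num, show (-1 : ℤ) + 1 = 0 by norm_num,
    show x + ε + ((-1 : ℤ) : ℝ) * ε = x by push_cast; ring,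
    show x + ε + (((-1 : ℤ) : ℝ) + 1) * ε = x + ε by push_cast; ring]
  unfold bracket2u
  simp only [Finset.sum_sub_distrib, ite_sum_left, ite_sum_right, Matrix.add_apply,
    Matrix.mul_apply]
  simp only [mul_comm (u ε p.1 x _ b), mul_comm (v ε p.1 (x + ε) _ b)]
  ring

theorem bracket2v_eq (G : DiffOp N) (hG : mul ε G (lax ε p.1) = mul ε (lax ε p.1) G)
    (a b : Fin N) (x : ℝ) :
    bracket2v ε p.1 (fun i j x => G 0 x j i) (fun i j x => G (-1) x i j) a b x
      = bracket1v ε p.1 (fun i j x => mul ε G (lax ε p.1) 0 x j i) a b x := by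
  -- The product is expanded as `LG` at `x` and as `GL` at `x - ε`, so that the cubic terms `v(x)
  -- G_1(x-ε) v(x)` cancel.
  have h1 : mul ε G (lax ε p.1) 0 x = G (-1) (x + ε) + u ε p.1 x * G 0 x
      + v ε p.1 x * G 1 (x - ε) := by rw [hG, lax_mul]; norm_num
  have h2 : mul ε G (lax ε p.1) 0 (x - ε) = G (-1) (x - ε) + G 0 (x - ε) * u ε p.1 (x - ε)
      + G 1 (x - ε) * v ε p.1 x := by rw [mul_lax]; norm_num
  have h3 : ∑ i, ∑ j, (u ε p.1 x a j * v ε p.1 x i b * G 0 x j i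
      - v ε p.1 x a j * u ε p.1 (x - ε) i b * G 0 (x - ε) j i)
      = (u ε p.1 x * G 0 x * v ε p.1 x) a b
        - (v ε p.1 x * (G 0 (x - ε) * u ε p.1 (x - ε))) a b := by
    rw [← mul_assoc]
    simp only [Matrix.mul_apply, Finset.sum_mul, Finset.sum_sub_distrib]
    congr 1 <;>
    exact Finset.sum_congr rfl fun i _ => Finset.sum_congr rfl fun j _ => by ring
  have h4 : ∑ s, (v ε p.1 x s b * G (-1) (x + ε) a s - v ε p.1 x a s * G (-1) (x - ε) s b)
      = (G (-1) (x + ε) * v ε p.1 x) a b - (v ε p.1 x * G (-1) (x - ε)) a b := by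
    simp only [Matrix.mul_apply, Finset.sum_sub_distrib, mul_comm (v ε p.1 x _ b)]
  rw [bracket1v_eq, h1, h2, bracket2v, h3, h4]
  simp only [add_mul, mul_add, Matrix.add_apply, mul_assoc]
  ring
end

end

section
variable {ε T : ℝ}

/-! ### The flows of the hierarchy -/

theorem lax_mul_S (p : Phase N ε T) : mul ε (lax ε p.1) p.1.S = mul ε p.1.S (mono 1 1) := by
  simp only [lax, opmul_assoc]
  rw [p.2.inv_mul_S, opmul_one]

/-- Comparing coefficients in `LS = SΛ` expresses `u` and `v` through the first two coefficients of
`S`. Their evolution thus needs the Sato equation for `S` in degrees -1 and -2 only. -/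
theorem u_eq (p : Phase N ε T) (x : ℝ) :
    u ε p.1 x = p.1.S (-1) x - p.1.S (-1) (x + ε) := by
  have h := congrFun (congrFun (lax_mul_S p) 0) x
  rw [lax_mul, mul_mono] at h
  simp only [zero_sub, zero_add, S_zero_apply, p.2.S_pos 1 one_pos, Pi.zero_apply, mul_zero,
    add_zero, mul_one] at h
  rw [← h]; abel

theorem v_eq (p : Phase N ε T) (x : ℝ) :
    v ε p.1 x = p.1.S (-2) x - p.1.S (-2) (x + ε) - u ε p.1 x * p.1.S (-1) x := by
  have h := congrFun (congrFun (lax_mul_S p) (-1)) x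
  rw [lax_mul, mul_mono, show (-1 : ℤ) - 1 = -2 by norm_num, neg_add_cancel, S_zero_apply] at h
  simp only [mul_one] at h
  rw [← h]; abel

theorem neg_mul_S_one (p : Phase N ε T) (G : DiffOp N) (x : ℝ) :
    mul ε (neg G) p.1.S (-1) x = G (-1) x := by
  rw [mul_eq_sum ε _ _ _ {-1}]
  · simp [neg, S_zero_apply]
  · intro m h1 h2
    have := (S_degLE p).le h2
    have h3 : m < 0 := by
      by_contra hc; exact h1 (by funext y; simp [neg, hc])
    rw [Finset.mem_singleton]; omega

theorem neg_mul_S_two (p : Phase N ε T) (G : DiffOp N) (x : ℝ) :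
    mul ε (neg G) p.1.S (-2) x = G (-2) x + G (-1) x * p.1.S (-1) (x - ε) := by
  rw [mul_eq_sum ε _ _ _ {-2, -1}, Finset.sum_pair (by norm_num)]
  · simp [neg, S_zero_apply, sub_eq_add_neg]
  · intro m h1 h2
    have := (S_degLE p).le h2
    have h3 : m < 0 := by
      by_contra hc; exact h1 (by funext y; simp [neg, hc])
    simp only [Finset.mem_insert, Finset.mem_singleton]; omega

section
variable {𝕜 : Type} [NontriviallyNormedField 𝕜] [NormedAlgebra 𝕜 ℂ] {f : Flow N}
  {γ : 𝕜 → Phase N ε T} {τ₀ : 𝕜}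

theorem SatoAt.hasDerivAt_u (hf : SatoAt f γ τ₀) (a b : Fin N) (x : ℝ) :
    HasDerivAt (fun τ => u ε (γ τ).1 x a b) ((1 / (ε : ℂ)) *
      (gen ε (γ τ₀).1 f (-1) (x + ε) a b - gen ε (γ τ₀).1 f (-1) x a b)) τ₀ := by
  have h1 := (hf (-1) x a b).1
  have h2 := (hf (-1) (x + ε) a b).1
  rw [neg_mul_S_one] at h1 h2
  have h3 := h1.sub h2
  have he : (fun τ => u ε (γ τ).1 x a b)
      = fun τ => (γ τ).1.S (-1) x a b - (γ τ).1.S (-1) (x + ε) a b := by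
    funext τ; rw [u_eq, Matrix.sub_apply]
  rw [he]
  refine h3.congr_deriv ?_
  ring

theorem SatoAt.hasDerivAt_v (hf : SatoAt f γ τ₀) (a b : Fin N) (x : ℝ) :
    HasDerivAt (fun τ => v ε (γ τ).1 x a b) ((1 / (ε : ℂ)) *
      ((gen ε (γ τ₀).1 f 0 x * v ε (γ τ₀).1 x) a b
        - (v ε (γ τ₀).1 x * gen ε (γ τ₀).1 f 0 (x - ε)) a b)) τ₀ := by
  have h1 := (hf (-2) x a b).1
  have h2 := (hf (-2) (x + ε) a b).1
  have h3 := fun c => (hf (-1) x c b).1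
  have h4 := fun c => hf.hasDerivAt_u a c x
  simp only [neg_mul_S_one, neg_mul_S_two, add_sub_cancel_right] at h1 h2 h3
  have h5 := (h1.sub h2).sub (HasDerivAt.fun_sum (u := Finset.univ) fun c _ => (h4 c).mul (h3 c))
  have he : (fun τ => v ε (γ τ).1 x a b)
      = fun τ => (γ τ).1.S (-2) x a b - (γ τ).1.S (-2) (x + ε) a b
        - ∑ c, u ε (γ τ).1 x a c * (γ τ).1.S (-1) x c b := by
    funext τ; rw [v_eq, Matrix.sub_apply, Matrix.sub_apply, Matrix.mul_apply]
  rw [he]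
  refine h5.congr_deriv ?_
  -- The Sato equation yields `G_{-2}`, `G_{-1}` and coefficients of `S`; the degree -1 part of `GL
  -- = LG`, with `u(x-ε)` written through `S`, eliminates them in favour of `G_0`.
  have hG := congrFun (congrFun (gen_commute (γ τ₀) f) (-1)) x
  rw [mul_lax, lax_mul, show (-1 : ℤ) - 1 = -2 by norm_num, neg_add_cancel,
    show x + ((-1 : ℤ) : ℝ) * ε = x - ε by push_cast; ring,
    show x + (((-1 : ℤ) : ℝ) + 1) * ε = x by push_cast; ring, u_eq (γ τ₀) (x - ε),
    sub_add_cancel] at hG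
  generalize gen ε (γ τ₀).1 f = G at *
  generalize (γ τ₀).1.S = S at *
  generalize v ε (γ τ₀).1 = V at *
  generalize u ε (γ τ₀).1 = U at *
  have hs : ∑ c, (1 / (ε : ℂ) * (G (-1) (x + ε) a c - G (-1) x a c) * S (-1) x c b
      + U x a c * (-(1 / (ε : ℂ)) * G (-1) x c b))
      = 1 / (ε : ℂ) * (((G (-1) (x + ε) - G (-1) x) * S (-1) x) a b - (U x * G (-1) x) a b) := by
    rw [Matrix.mul_apply, Matrix.mul_apply, ← Finset.sum_sub_distrib, Finset.mul_sum]
    refine Finset.sum_congr rfl fun c _ => ?_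
    rw [Matrix.sub_apply]; ring
  have hM : G 0 x * V x - V x * G 0 (x - ε)
      = -(G (-2) x + G (-1) x * S (-1) (x - ε)) + (G (-2) (x + ε) + G (-1) (x + ε) * S (-1) x)
        - ((G (-1) (x + ε) - G (-1) x) * S (-1) x - U x * G (-1) x) := by
    rw [mul_sub] at hG
    rw [sub_mul, ← sub_eq_zero]
    rw [← sub_eq_zero] at hG
    rw [← hG]; abel
  rw [hs, ← Matrix.sub_apply (G 0 x * V x), hM]
  simp only [Matrix.sub_apply, Matrix.add_apply, Matrix.neg_apply]
  ring
end

/-! ### Linearity of the first bracket -/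

theorem bracket1v_comb (p : Phase N ε T) (c₁ c₂ : ℂ) (A : DiffOp N) (F : Fin N → DiffOp N)
    (a b : Fin N) (x : ℝ) :
    bracket1v ε p.1 (fun i j x => (c₁ • A + c₂ • ∑ k, F k) 0 x j i) a b x
      = c₁ * bracket1v ε p.1 (fun i j x => A 0 x j i) a b x
        + c₂ * ∑ k, bracket1v ε p.1 (fun i j x => F k 0 x j i) a b x := by
  have hc : ∀ y, (c₁ • A + c₂ • ∑ k, F k) 0 y = c₁ • A 0 y + c₂ • ∑ k, F k 0 y := fun y => by
    simp [Finset.sum_apply]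
  rw [bracket1v_eq p (c₁ • A + c₂ • ∑ k, F k), hc, hc]
  simp only [bracket1v_eq]
  rw [← Finset.mul_sum, Finset.sum_sub_distrib]
  simp only [add_mul, mul_add, smul_mul_assoc, mul_smul_comm, Finset.sum_mul, Finset.mul_sum,
    Matrix.add_apply, Matrix.smul_apply, smul_eq_mul, Matrix.sum_apply]
  simp only [← Finset.mul_sum]
  ring

theorem comb_apply (c₁ c₂ : ℂ) (A : DiffOp N) (F : Fin N → DiffOp N) (n : ℤ) (x : ℝ)
    (a b : Fin N) :
    (c₁ • A + c₂ • ∑ k, F k) n x a b = c₁ * A n x a b + c₂ * ∑ k, F k n x a b := by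
  simp [Finset.sum_apply, Matrix.sum_apply]
end

end EMTH

end

/-! ### The theorem -/

theorem mainTheorem6 (N : ℕ) (ε T : ℝ) (hε : ε ≠ 0) (hT : 0 < T) :
    ∃ du dv R : EMTH.Flow N → EMTH.Phase N ε T → Fin N → Fin N → ℝ → ℂ,
      -- variational derivatives of the Hamiltonians, and the non-local terms of the second bracket
      (∀ (f : EMTH.Flow N) (p : EMTH.Phase N ε T),
        EMTH.IsVarDeriv (EMTH.Ham f) p (du f p) (dv f p) ∧
        EMTH.IsNonlocalTerm ε T p.1 (du f p) (dv f p) (R f p)) ∧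
      -- every flow is Hamiltonian with respect to the first bracket
      (∀ (f : EMTH.Flow N) (𝕜 : Type) [NontriviallyNormedField 𝕜] [NormedAlgebra 𝕜 ℂ]
          (γ : 𝕜 → EMTH.Phase N ε T) (τ₀ : 𝕜), EMTH.SatoAt f γ τ₀ →
        ∀ (a b : Fin N) (x : ℝ),
          HasDerivAt (fun τ => EMTH.u ε (γ τ).1 x a b)
            (EMTH.bracket1u ε (γ τ₀).1 (du f (γ τ₀)) (dv f (γ τ₀)) a b x) τ₀ ∧
          HasDerivAt (fun τ => EMTH.v ε (γ τ).1 x a b)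
            (EMTH.bracket1v ε (γ τ₀).1 (du f (γ τ₀)) a b x) τ₀) ∧
      -- recursion for `H_{n,k}`
      (∀ (n : ℕ) (k : Fin N) (p : EMTH.Phase N ε T) (a b : Fin N) (x : ℝ), 1 ≤ n →
        EMTH.bracket2u ε p.1 (du (.t (n - 1) k) p) (R (.t (n - 1) k) p) a b x
          = EMTH.bracket1u ε p.1 (du (.t n k) p) (dv (.t n k) p) a b x ∧
        EMTH.bracket2v ε p.1 (du (.t (n - 1) k) p) (R (.t (n - 1) k) p) a b x
          = EMTH.bracket1v ε p.1 (du (.t n k) p) a b x) ∧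
      -- recursion for `H̄_{n,k}`
      (∀ (n : ℕ) (k : Fin N) (p : EMTH.Phase N ε T) (a b : Fin N) (x : ℝ), 1 ≤ n →
        EMTH.bracket2u ε p.1 (du (.tbar (n - 1) k) p) (R (.tbar (n - 1) k) p) a b x
          = EMTH.bracket1u ε p.1 (du (.tbar n k) p) (dv (.tbar n k) p) a b x ∧
        EMTH.bracket2v ε p.1 (du (.tbar (n - 1) k) p) (R (.tbar (n - 1) k) p) a b x
          = EMTH.bracket1v ε p.1 (du (.tbar n k) p) a b x) ∧
      -- recursion for `H̃_n`
      (∀ (n : ℕ) (p : EMTH.Phase N ε T) (a b : Fin N) (x : ℝ), 1 ≤ n →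
        EMTH.bracket2u ε p.1 (du (.s (n - 1)) p) (R (.s (n - 1)) p) a b x
          = (n : ℂ) * EMTH.bracket1u ε p.1 (du (.s n) p) (dv (.s n) p) a b x
            + (2 / (n.factorial : ℂ)) *
              ∑ k : Fin N, EMTH.bracket1u ε p.1 (du (.t n k) p) (dv (.t n k) p) a b x ∧
        EMTH.bracket2v ε p.1 (du (.s (n - 1)) p) (R (.s (n - 1)) p) a b x
          = (n : ℂ) * EMTH.bracket1v ε p.1 (du (.s n) p) a b x
            + (2 / (n.factorial : ℂ)) *
              ∑ k : Fin N, EMTH.bracket1v ε p.1 (du (.t n k) p) a b x) := by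
  -- The transposition in the first two witnesses comes from the trace pairing and the shift by `-ε`
  -- from `tint_mul_band`. The third is the solution of the difference equation found in
  -- `nonlocalSource_eq`, without transposition.
  refine ⟨fun f p i j x => EMTH.gen ε p.1 f 0 x j i,
    fun f p i j x => EMTH.gen ε p.1 f 1 (x - ε) j i,
    fun f p i j x => EMTH.gen ε p.1 f (-1) x i j, ?_, ?_, ?_, ?_, ?_⟩
  · refine fun f p => ⟨EMTH.isVarDeriv_Ham hε f p, ⟨fun i j => ⟨(EMTH.smo_gen p f).out (-1) i j,
      fun x => congrFun (congrFun ((EMTH.per_gen p f).out (-1) x) i) j⟩, fun i j x => ?_⟩⟩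
    exact (EMTH.nonlocalSource_eq p _ (EMTH.gen_commute p f) i j x).symm
  · intro f 𝕜 _ _ γ τ₀ hf a b x
    have hu := hf.hasDerivAt_u a b x
    have hv := hf.hasDerivAt_v a b x
    rw [← EMTH.bracket1u_eq _ _ (EMTH.gen_commute (γ τ₀) f)] at hu
    rw [← EMTH.bracket1v_eq] at hv
    exact ⟨hu, hv⟩
  · rintro n k p a b x hn
    obtain ⟨m, rfl⟩ : ∃ m, n = m + 1 := ⟨n - 1, by omega⟩
    have h2 := EMTH.bracket2u_eq p _ (EMTH.gen_commute p (.t m k)) a b x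
    have h3 := EMTH.bracket2v_eq p _ (EMTH.gen_commute p (.t m k)) a b x
    have h1 := EMTH.bracket1u_eq p _ (EMTH.gen_commute p (.t (m + 1) k)) a b x
    have e : EMTH.mul ε (EMTH.gen ε p.1 (.t m k)) (EMTH.lax ε p.1)
      = EMTH.gen ε p.1 (.t (m + 1) k) := EMTH.B_succ p m k
    rw [e] at h2 h3
    exact ⟨h2.trans h1.symm, h3⟩
  · rintro n k p a b x hn
    obtain ⟨m, rfl⟩ : ∃ m, n = m + 1 := ⟨n - 1, by omega⟩
    have h2 := EMTH.bracket2u_eq p _ (EMTH.gen_commute p (.tbar m k)) a b x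
    have h3 := EMTH.bracket2v_eq p _ (EMTH.gen_commute p (.tbar m k)) a b x
    have h1 := EMTH.bracket1u_eq p _ (EMTH.gen_commute p (.tbar (m + 1) k)) a b x
    have e : EMTH.mul ε (EMTH.gen ε p.1 (.tbar m k)) (EMTH.lax ε p.1)
      = EMTH.gen ε p.1 (.tbar (m + 1) k) := EMTH.Bbar_succ p m k
    rw [e] at h2 h3
    exact ⟨h2.trans h1.symm, h3⟩
  · rintro n p a b x hn
    obtain ⟨m, rfl⟩ : ∃ m, n = m + 1 := ⟨n - 1, by omega⟩
    have h2 := EMTH.bracket2u_eq p _ (EMTH.gen_commute p (.s m)) a b x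
    have h3 := EMTH.bracket2v_eq p _ (EMTH.gen_commute p (.s m)) a b x
    have h1 := EMTH.bracket1u_eq p _ (EMTH.gen_commute p (.s (m + 1))) a b x
    have h4 := fun k => EMTH.bracket1u_eq p _ (EMTH.gen_commute p (.t (m + 1) k)) a b x
    have e : EMTH.mul ε (EMTH.gen ε p.1 (.s m)) (EMTH.lax ε p.1)
      = ((m + 1 : ℕ) : ℂ) • EMTH.gen ε p.1 (.s (m + 1))
        + (2 / ((m + 1).factorial : ℂ)) • ∑ k, EMTH.gen ε p.1 (.t (m + 1) k) := EMTH.D_succ p m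
    rw [e] at h2 h3
    -- For `u` only the degree -1 coefficient of the combined generator enters, so linearity is
    -- needed for coefficients; for `v` linearity of the first bracket itself is used.
    rw [EMTH.comb_apply, EMTH.comb_apply] at h2
    rw [EMTH.bracket1v_comb] at h3
    refine ⟨h2.trans ?_, h3⟩
    simp only [h1, h4]
    rw [← Finset.mul_sum, Finset.sum_sub_distrib]
    ring
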